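/- Let $M,N,k\ge 1$, let $\mathbf s\neq 0$ be a complex pilot vector with Euclidean norm $|\mathbf s|$, and let $\sigma_\beta,\sigma_z>0$. For $\mathbf x=(x_1,x_2)^{\mathsf T}\in\mathbb R^2$ put $\mathbf a(\mathbf x)=\mathbf a_1(x_1)\otimes \mathbf a_2(x_2)\in\mathbb C^{MN}$, where $\mathbf a_1(x_1)=\big(e^{2\pi i m x_1/M}\big)_{m=0}^{M-1}$ and $\mathbf a_2(x_2)=\big(e^{2\pi i n x_2/N}\big)_{n=0}^{N-1}$. Let $\mathbf W_1,\dots,\mathbf W_k\in\mathbb C^{MN\times 3}$ be given (deterministic) matrices. For a static direction $\mathbf x$ the observations are $$\mathbf y_l=|\mathbf s|\,\beta_l\,\mathbf W_l^{\mathsf H}\mathbf a(\mathbf x)+\mathbf z_l,\qquad l=1,\dots,k,$$ where the equivalent channel gains $\beta_l\sim\mathcal{CN}(0,\sigma_\beta^2)$ (Rayleigh fading) and the three entries of every noise vector $\mathbf z_l$, each distributed as $\mathcal{CN}(0,\sigma_z^2)$, are all mutually independent; $\sigma_\beta^2$ is a known constant that does not depend on $\mathbf x$. Let $$\mathbf g_l=\mathbf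 W_l^{\mathsf H}\mathbf a(\mathbf x),\quad \tilde g_{l,p}=\frac{\partial |\mathbf g_l|^2}{\partial x_p},\quad \mathbf G_{l,p}=\frac{\partial\, \mathbf g_l\mathbf g_l^{\mathsf H}}{\partial x_p}\ (p=1,2),\quad \boldsymbol\Sigma_l=|\mathbf s|^2\sigma_\beta^2\,\mathbf g_l\mathbf g_l^{\mathsf H}+\sigma_z^2\mathbf J_3,$$ where $\mathbf J_3$ is the $3\times3$ identity matrix, let $p_{DI}(\mathbf y\mid\mathbf x,\mathbf W_l)=\pi^{-3}(\det\boldsymbol\Sigma_l)^{-1}e^{-\mathbf y^{\mathsf H}\boldsymbol\Sigma_l^{-1}\mathbf y}$, and let $$\mathbf I_{DI}(\mathbf x,\mathbf W_l)=\mathbb E\Big[\frac{\partial\log p_{DI}(\mathbf y\mid\mathbf x,\mathbf W_l)}{\partial\mathbf x}\cdot\frac{\partial\log p_{DI}(\mathbf y\mid\mathbf x,\mathbf W_l)}{\partial\mathbf x^{\mathsf T}}\Big],\qquad \mathbf y\sim p_{DI}(\cdot\mid\mathbf x,\mathbf W_l),$$ be the $2\times 2$ Fisher information matrix. Fix $\mathbf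 x\in\mathbb R^2$. (1) Let $\hat{\mathbf x}_k=F(\mathbf y_1,\dots,\mathbf y_k)$, with $F$ measurable and $\mathbb R^2$-valued, be an estimate that is unbiased at all directions in a neighbourhood of $\mathbf x$, i.e. its expectation exists and equals the true direction whenever the true direction lies in that neighbourhood. If $\sum_{l=1}^k\mathbf I_{DI}(\mathbf x,\mathbf W_l)$ is invertible, then $$\mathbb E\big[\|\hat{\mathbf x}_k-\mathbf x\|_2^2\big]\ \ge\ \operatorname{Tr}\Big\{\Big(\sum_{l=1}^k\mathbf I_{DI}(\mathbf x,\mathbf W_l)\Big)^{-1}\Big\},$$ where the expectation, taken under the true direction $\mathbf x$, may be $+\infty$. (2) For all $l=1,\dots,k$ and $p,j\in\{1,2\}$ the expectation that defines $[\mathbf I_{DI}(\mathbf x,\mathbf W_l)]_{p,j}$ is finite (the integrand is integrable) and $$[\mathbf I_{DI}(\mathbf x,\mathbf W_l)]_{p,j}=\frac{\sigma_z^6|\mathbf s|^6\sigma_\beta^6}{(\det\boldsymbol\Sigma_l)^2}\Big\{-2|\mathbf g_l|^2\tilde g_{l,p}\tilde g_{l,j}+\frac{\sigma_z^2}{|\mathbf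 s|^2\sigma_\beta^2}\operatorname{Tr}\{\mathbf G_{l,p}\mathbf G_{l,j}\}+\mathbf g_l^{\mathsf H}\big(\mathbf G_{l,p}\mathbf G_{l,j}+\mathbf G_{l,j}\mathbf G_{l,p}\big)\mathbf g_l\Big\}.$$ -/

import Mathlib

open MeasureTheory ProbabilityTheory Filter Topology
open scoped Matrix NNReal ENNReal

namespace BeamTracking

noncomputable section

/-- The circularly symmetric complex Gaussian law `CN(0, σ²)`: real and imaginary parts are
independent real Gaussians of mean `0` and variance `σ² / 2`. -/
def complexGaussian (σ : ℝ) : Measure ℂ :=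
  ((gaussianReal 0 (Real.toNNReal (σ ^ 2 / 2))).prod
    (gaussianReal 0 (Real.toNNReal (σ ^ 2 / 2)))).map fun u : ℝ × ℝ => (⟨u.1, u.2⟩ : ℂ)

/-- One-dimensional steering vector `[1, e^{j2πt/n}, …, e^{j2π(n-1)t/n}]`. -/
def steering₁ (n : ℕ) (t : ℝ) : Fin n → ℂ := fun m =>
  Complex.exp (Complex.I * (2 * Real.pi * ((m : ℕ) : ℝ) / (n : ℝ) * t : ℝ))

/-- Two-dimensional steering vector `a(x) = a₁(x₁) ⊗ a₂(x₂)`; the entries of the Kronecker product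
are indexed by pairs. -/
def steering (M N : ℕ) (x : EuclideanSpace ℝ (Fin 2)) : Fin M × Fin N → ℂ := fun q =>
  steering₁ M (x 0) q.1 * steering₁ N (x 1) q.2

variable {M N : ℕ}

/-- `g = Wᴴ a(x)`. -/
def gVec (W : Matrix (Fin M × Fin N) (Fin 3) ℂ) (x : EuclideanSpace ℝ (Fin 2)) : Fin 3 → ℂ :=
  Wᴴ *ᵥ steering M N x

/-- `|g|²`, the squared Euclidean modulus of `g = Wᴴ a(x)`. -/
def gSq (W : Matrix (Fin M × Fin N) (Fin 3) ℂ) (x : EuclideanSpace ℝ (Fin 2)) : ℝ :=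
  ∑ i, ‖gVec W x i‖ ^ 2

/-- `g gᴴ`. -/
def gOuter (W : Matrix (Fin M × Fin N) (Fin 3) ℂ) (x : EuclideanSpace ℝ (Fin 2)) :
    Matrix (Fin 3) (Fin 3) ℂ :=
  Matrix.vecMulVec (gVec W x) (star (gVec W x))

/-- The partial derivative `∂f/∂x_p` at `x`. -/
def partialD {E : Type*} [NormedAddCommGroup E] [NormedSpace ℝ E]
    (f : EuclideanSpace ℝ (Fin 2) → E) (p : Fin 2) (x : EuclideanSpace ℝ (Fin 2)) : E :=
  lineDeriv ℝ f x (EuclideanSpace.single p (1 : ℝ))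

/-- `g̃_p = ∂|g|²/∂x_p`. -/
def gTilde (W : Matrix (Fin M × Fin N) (Fin 3) ℂ) (x : EuclideanSpace ℝ (Fin 2)) (p : Fin 2) : ℝ :=
  partialD (gSq W) p x

/-- `G_p = ∂(g gᴴ)/∂x_p`, entry by entry. -/
def gMat (W : Matrix (Fin M × Fin N) (Fin 3) ℂ) (x : EuclideanSpace ℝ (Fin 2)) (p : Fin 2) :
    Matrix (Fin 3) (Fin 3) ℂ :=
  Matrix.of fun i i' => partialD (fun x' => gOuter W x' i i') p x

/-- The observation vector `y = |s| β Wᴴ a(x) + z` for the equivalent channel gain `β`, the noise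
vector `z` and the modulus `S = |s|` of the pilot sequence. -/
def observation (S : ℝ) (W : Matrix (Fin M × Fin N) (Fin 3) ℂ) (x : EuclideanSpace ℝ (Fin 2))
    (β : ℂ) (z : Fin 3 → ℂ) : Fin 3 → ℂ :=
  ((S : ℂ) * β) • gVec W x + z

/-- The covariance matrix `Σ_y = |s|² σ_β² g gᴴ + σ_z² J₃` of the observation vector. -/
def covDI (S σβ σz : ℝ) (W : Matrix (Fin M × Fin N) (Fin 3) ℂ) (x : EuclideanSpace ℝ (Fin 2)) :
    Matrix (Fin 3) (Fin 3) ℂ :=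
  ((S ^ 2 * σβ ^ 2 : ℝ) : ℂ) • gOuter W x + ((σz ^ 2 : ℝ) : ℂ) • (1 : Matrix (Fin 3) (Fin 3) ℂ)

/-- The density `p_DI(y | x, W) = exp(-yᴴ Σ_y⁻¹ y) / (π³ |Σ_y|)`. The determinant and the quadratic
form are real because `Σ_y` is Hermitian. -/
def pDI (S σβ σz : ℝ) (W : Matrix (Fin M × Fin N) (Fin 3) ℂ) (x : EuclideanSpace ℝ (Fin 2))
    (y : Fin 3 → ℂ) : ℝ :=
  1 / (Real.pi ^ 3 * (covDI S σβ σz W x).det.re) *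
    Real.exp (-(star y ⬝ᵥ ((covDI S σβ σz W x)⁻¹ *ᵥ y)).re)

/-- The score `∂ log p_DI(y | x, W) / ∂x_p`. -/
def scoreDI (S σβ σz : ℝ) (W : Matrix (Fin M × Fin N) (Fin 3) ℂ) (x : EuclideanSpace ℝ (Fin 2))
    (p : Fin 2) (y : Fin 3 → ℂ) : ℝ :=
  partialD (fun x' => Real.log (pDI S σβ σz W x' y)) p x

/-- The Fisher information matrix
`I_DI(x, W) = E[(∂ log p_DI / ∂x) (∂ log p_DI / ∂xᵀ)]`, where `y` has density `p_DI(· | x, W)`. -/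
def fisherDI (S σβ σz : ℝ) (W : Matrix (Fin M × Fin N) (Fin 3) ℂ) (x : EuclideanSpace ℝ (Fin 2)) :
    Matrix (Fin 2) (Fin 2) ℝ :=
  Matrix.of fun p j =>
    ∫ y, scoreDI S σβ σz W x p y * scoreDI S σβ σz W x j y * pDI S σβ σz W x y

end

end BeamTracking

/-! Write `c = S²σβ²`, `P = g gᴴ` and `D = σz² + c|g|²`. The covariance `Σ = cP + σz²` is a rank-one
perturbation of a scalar matrix, so `det Σ = σz⁴D` and `Σ⁻¹ = σz⁻²(1 - (c/D)P)`. Hence `log p` is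
smooth in the direction, and its `p`-th score is `yᴴB_p y - tr(B_pΣ)` with `B_p = -∂_pΣ⁻¹`
(`scoreMat`).

An observation is `Lw` for the vector `w` of gain and noise, whose independent entries have a
diagonal variance matrix `V` with `LVLᴴ = Σ`. Integrating out the gain by completing the square
shows that its law has density `p_DI` (`map_observe`). Moments of quadratic forms in `y` become
moments in `w`, where Wick's formula (`integral_quadratic_mul`) gives `E[yᴴBy · yᴴCy] = tr(BΣ)tr(CΣ)
+ tr(BΣCΣ)`. So the score is centred and the Fisher entry is `tr(B_pΣB_jΣ)`; expanding this trace
yields the closed form (`fisherDI_eq`).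

For the bound, an infinite mean square error is trivial; otherwise the error `T` is square
integrable. Gaussian decay of the density then allows differentiation of `E T_i` in the direction
(`hasDerivAt_integral_mul_exp`), and unbiasedness near `x` turns this into `E[T_i Z_p] = δ_ip` for
the joint score `Z`. Independence makes the Fisher information `J` of `Z` the sum over the cycles.
With `A = J⁻¹`, positivity of `E(T_i - ∑ A_ip Z_p)²` gives `E T_i² ≥ A_ii`, and summation over `i`
gives the trace (`trace_inv_le_integral_norm_sq`). -/

namespace BeamTracking

/-! ### Densities of product measures and of the complex Gaussian law. -/

/-- A product of measures with real densities has the product density. -/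
theorem pi_withDensity_ofReal {ι : Type*} [Fintype ι] {E : ι → Type*}
    [∀ i, MeasurableSpace (E i)] (μ : ∀ i, Measure (E i)) [∀ i, SigmaFinite (μ i)]
    (f : ∀ i, E i → ℝ) (hf : ∀ i, Integrable (f i) (μ i)) (h0 : ∀ i v, 0 ≤ f i v) :
    Measure.pi (fun i => (μ i).withDensity fun v => ENNReal.ofReal (f i v)) =
      (Measure.pi μ).withDensity fun v => ENNReal.ofReal (∏ i, f i (v i)) := by
  have hfin (i) : IsFiniteMeasure ((μ i).withDensity fun v => ENNReal.ofReal (f i v)) :=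
    isFiniteMeasure_withDensity_ofReal (hf i).2
  refine Measure.pi_eq fun s hs => ?_
  have hint : Integrable (fun v : ∀ i, E i => ∏ i, f i (v i))
      (Measure.pi fun i => (μ i).restrict (s i)) :=
    Integrable.fintype_prod_dep fun i => (hf i).restrict
  rw [withDensity_apply _ (MeasurableSet.univ_pi hs), Measure.restrict_pi_pi,
    ← ofReal_integral_eq_lintegral_ofReal hint
      (ae_of_all _ fun v => Finset.prod_nonneg fun i _ => h0 i _),
    integral_fintype_prod_eq_prod,
    ENNReal.ofReal_prod_of_nonneg fun i _ => integral_nonneg fun v => h0 i v]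
  refine Finset.prod_congr rfl fun i _ => ?_
  rw [withDensity_apply _ (hs i),
    ofReal_integral_eq_lintegral_ofReal (hf i).restrict (ae_of_all _ fun v => h0 i v)]

/-- The density of the law `CN(0, σ²)`. -/
noncomputable def complexGaussianPDF (σ : ℝ) (w : ℂ) : ℝ :=
  Real.exp (-(1 / σ ^ 2) * ‖w‖ ^ 2) / (Real.pi * σ ^ 2)

theorem complexGaussianPDF_nonneg (σ : ℝ) (w : ℂ) : 0 ≤ complexGaussianPDF σ w := by
  unfold complexGaussianPDF
  have := Real.pi_pos
  positivity

@[fun_prop]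
theorem continuous_complexGaussianPDF (σ : ℝ) : Continuous (complexGaussianPDF σ) := by
  unfold complexGaussianPDF
  fun_prop

theorem complexGaussian_eq_withDensity {σ : ℝ} (hσ : 0 < σ) :
    complexGaussian σ = volume.withDensity fun w => ENNReal.ofReal (complexGaussianPDF σ w) := by
  have hv : Real.toNNReal (σ ^ 2 / 2) ≠ 0 := by
    rw [Ne, Real.toNNReal_eq_zero]; push Not; positivity
  unfold complexGaussian
  rw [gaussianReal_of_var_ne_zero 0 hv, prod_withDensity (by fun_prop) (by fun_prop)]
  ext s hs
  -- The identification of `ℂ` with `ℝ × ℝ` preserves volume, so the product of the two real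
  -- densities carries over.
  have hmp := Complex.volume_preserving_equiv_real_prod
  rw [withDensity_apply _ hs]
  have hm : (fun u : ℝ × ℝ => (⟨u.1, u.2⟩ : ℂ)) = Complex.measurableEquivRealProd.symm := rfl
  rw [hm, MeasurableEquiv.map_apply,
    withDensity_apply _ (Complex.measurableEquivRealProd.symm.measurable hs),
    ← (hmp.symm _).setLIntegral_comp_preimage hs (by fun_prop)]
  refine lintegral_congr fun u => ?_
  rw [gaussianPDF, gaussianPDF, ← ENNReal.ofReal_mul (gaussianPDFReal_nonneg _ _ _)]
  congr 1
  rw [gaussianPDFReal, gaussianPDFReal, complexGaussianPDF,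
    Complex.measurableEquivRealProd_symm_apply, ← Complex.normSq_eq_norm_sq, Complex.normSq_mk,
    Real.coe_toNNReal _ (by positivity : (0 : ℝ) ≤ σ ^ 2 / 2)]
  have hpi := Real.pi_pos
  rw [mul_mul_mul_comm, ← Real.exp_add, ← mul_inv, Real.mul_self_sqrt (by positivity),
    div_eq_mul_inv, mul_comm]
  congr 1
  · congr 1
    field_simp
    ring
  · congr 1
    field_simp

instance (σ : ℝ) : IsProbabilityMeasure (complexGaussian σ) := by
  unfold complexGaussian
  exact Measure.isProbabilityMeasure_map
    (Complex.measurableEquivRealProd.symm.measurable.aemeasurable)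

theorem integrable_complexGaussian_iff {σ : ℝ} (hσ : 0 < σ) {f : ℂ → ℂ} :
    Integrable f (complexGaussian σ) ↔ Integrable fun w => (complexGaussianPDF σ w : ℂ) * f w := by
  rw [complexGaussian_eq_withDensity hσ, integrable_withDensity_iff_integrable_smul']
  · refine integrable_congr (ae_of_all _ fun w => ?_)
    simp [ENNReal.toReal_ofReal (complexGaussianPDF_nonneg σ w)]
  · fun_prop
  · exact ae_of_all _ fun w => ENNReal.ofReal_lt_top

theorem integral_complexGaussian {σ : ℝ} (hσ : 0 < σ) (f : ℂ → ℂ) :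
    ∫ w, f w ∂complexGaussian σ = ∫ w, (complexGaussianPDF σ w : ℂ) * f w := by
  rw [complexGaussian_eq_withDensity hσ, integral_withDensity_eq_integral_toReal_smul]
  · refine integral_congr_ae (ae_of_all _ fun w => ?_)
    simp [ENNReal.toReal_ofReal (complexGaussianPDF_nonneg σ w)]
  · fun_prop
  · exact ae_of_all _ fun w => ENNReal.ofReal_lt_top

end BeamTracking

/-! ### Moments of one complex Gaussian variable. -/

namespace BeamTracking

open scoped ComplexConjugate

theorem complexGaussianPDF_eq_of_norm_eq {σ : ℝ} {v w : ℂ} (h : ‖v‖ = ‖w‖) :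
    complexGaussianPDF σ v = complexGaussianPDF σ w := by
  simp [complexGaussianPDF, h]

theorem integral_norm_pow_mul_complexGaussianPDF {σ : ℝ} (hσ : 0 < σ) (n : ℕ) :
    ∫ w, complexGaussianPDF σ w * ‖w‖ ^ (2 * n) = n.factorial * σ ^ (2 * n) := by
  have hpi := Real.pi_pos
  have h := Complex.integral_rpow_mul_exp_neg_mul_rpow (p := 2) (q := (2 * n : ℕ))
    (b := 1 / σ ^ 2) one_le_two (lt_of_lt_of_le (by norm_num) (Nat.cast_nonneg _)) (by positivity)
  have e1 : -(((2 * n : ℕ) : ℝ) + 2) / 2 = -((n + 1 : ℕ) : ℝ) := by push_cast; ring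
  have e2 : (((2 * n : ℕ) : ℝ) + 2) / 2 = (n : ℝ) + 1 := by push_cast; ring
  rw [e1, e2, Real.Gamma_nat_eq_factorial, Real.rpow_neg (by positivity), Real.rpow_natCast] at h
  calc _ = ∫ w : ℂ, (‖w‖ ^ ((2 * n : ℕ) : ℝ) * Real.exp (-(1 / σ ^ 2) * ‖w‖ ^ (2 : ℝ))) *
        (1 / (Real.pi * σ ^ 2)) := by
        refine integral_congr_ae (ae_of_all _ fun w => ?_)
        simp only [Real.rpow_natCast, Real.rpow_two, complexGaussianPDF]
        ring
    _ = _ := by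
        rw [integral_mul_const, h, one_div, inv_pow, inv_inv]
        field_simp
        ring

theorem integrable_norm_pow_mul_complexGaussianPDF {σ : ℝ} (hσ : 0 < σ) (n : ℕ) :
    Integrable fun w => complexGaussianPDF σ w * ‖w‖ ^ (2 * n) := by
  -- The Bochner integral of a non-integrable function is zero, so a nonzero value already proves
  -- integrability.
  refine Integrable.of_integral_ne_zero ?_
  rw [integral_norm_pow_mul_complexGaussianPDF hσ]
  positivity

theorem integrable_complexGaussianPDF {σ : ℝ} (hσ : 0 < σ) :
    Integrable (complexGaussianPDF σ) := by
  simpa using integrable_norm_pow_mul_complexGaussianPDF hσ 0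

/-- All mixed moments of a complex Gaussian variable exist. -/
theorem integrable_complexGaussian_pow_mul_conj_pow {σ : ℝ} (hσ : 0 < σ) (m n : ℕ) :
    Integrable (fun w => w ^ m * conj w ^ n) (complexGaussian σ) := by
  rw [integrable_complexGaussian_iff hσ]
  -- The bound `|w|^(m+n) ≤ |w|^(2m) + |w|^(2n)` reduces the claim to even absolute moments.
  refine ((integrable_norm_pow_mul_complexGaussianPDF hσ m).add
    (integrable_norm_pow_mul_complexGaussianPDF hσ n)).mono'
    (Continuous.aestronglyMeasurable (by fun_prop)) (ae_of_all _ fun w => ?_)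
  have h0 := complexGaussianPDF_nonneg σ w
  simp only [norm_mul, norm_pow, RCLike.norm_conj, Complex.norm_real, Real.norm_eq_abs,
    abs_of_nonneg h0, Pi.add_apply, ← mul_add]
  refine mul_le_mul_of_nonneg_left ?_ h0
  rw [pow_mul', pow_mul']
  nlinarith [sq_nonneg (‖w‖ ^ m - ‖w‖ ^ n), sq_nonneg (‖w‖ ^ m + ‖w‖ ^ n)]

theorem integral_complexGaussian_pow_mul_conj_pow {σ : ℝ} (hσ : 0 < σ) (m n : ℕ) :
    ∫ w, w ^ m * conj w ^ n ∂complexGaussian σ =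
      if m = n then (m.factorial * σ ^ (2 * m) : ℂ) else 0 := by
  rw [integral_complexGaussian hσ]
  split_ifs with h
  · subst h
    have := integral_norm_pow_mul_complexGaussianPDF hσ m
    apply_fun ((↑) : ℝ → ℂ) at this
    rw [← integral_complex_ofReal] at this
    push_cast at this
    rw [← this]
    refine integral_congr_ae (ae_of_all _ fun w => ?_)
    simp only [← mul_pow, Complex.mul_conj, Complex.normSq_eq_norm_sq, pow_mul, Complex.ofReal_pow]
  · have hmn : ((m : ℝ) - n) ≠ 0 := sub_ne_zero.mpr (by exact_mod_cast h)
    -- The angle is chosen so that rotation by `c` multiplies `w^m * conj w^n` by `e^(iπ) = -1`. The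
    -- density is rotation invariant, so the integral equals its own negative.
    let c : Circle := Circle.exp (Real.pi / (m - n))
    have hc : (c : ℂ) ^ m * conj (c : ℂ) ^ n = -1 := by
      have : conj (c : ℂ) = (c : ℂ)⁻¹ := by rw [← Circle.coe_inv_eq_conj, Circle.coe_inv]
      rw [this, Circle.coe_exp, ← Complex.exp_neg, ← Complex.exp_nat_mul, ← Complex.exp_nat_mul,
        ← Complex.exp_add, ← Complex.exp_pi_mul_I]
      congr 1
      have h2 : ((m : ℂ) - n) ≠ 0 := by exact_mod_cast hmn
      push_cast
      field_simp
      ring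
    have hrot := (rotation c).measurePreserving.integral_comp
      (rotation c).toHomeomorph.measurableEmbedding
      (fun w => (complexGaussianPDF σ w : ℂ) * (w ^ m * conj w ^ n))
    have h2 : ∀ w : ℂ, (complexGaussianPDF σ (rotation c w) : ℂ) *
        (rotation c w ^ m * conj (rotation c w) ^ n) =
        -((complexGaussianPDF σ w : ℂ) * (w ^ m * conj w ^ n)) := fun w => by
      rw [complexGaussianPDF_eq_of_norm_eq ((rotation c).norm_map w), rotation_apply, map_mul,
        mul_pow, mul_pow, mul_mul_mul_comm ((c : ℂ) ^ m), hc]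
      ring
    simp_rw [h2] at hrot
    rw [integral_neg] at hrot
    exact self_eq_neg.mp hrot.symm

/-! ### Wick's formula for four independent complex Gaussian variables. -/

section Wick

variable (τ : Fin 4 → ℝ)

/-- The law of independent circularly symmetric complex Gaussian variables. -/
noncomputable abbrev gaussianPi : Measure (Fin 4 → ℂ) := Measure.pi fun m => complexGaussian (τ m)

/-- Adding the indicators in the exponent also covers `a = b`, where the coordinate occurs squared.
Written as products over all coordinates, monomials can be integrated one factor at a time. -/
theorem prod_pow_indicator_add (w : Fin 4 → ℂ) (a b : Fin 4) :
    ∏ m, w m ^ ((if m = a then 1 else 0) + if m = b then 1 else 0) = w a * w b := by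
  simp_rw [pow_add, Finset.prod_mul_distrib]
  simp [pow_ite]

theorem fourth_monomial_eq_prod (w : Fin 4 → ℂ) (a b c d : Fin 4) :
    conj (w a) * w b * (conj (w c) * w d) =
      ∏ m, (w m ^ ((if m = b then 1 else 0) + if m = d then 1 else 0) *
        conj (w m) ^ ((if m = a then 1 else 0) + if m = c then 1 else 0)) := by
  rw [Finset.prod_mul_distrib, prod_pow_indicator_add, prod_pow_indicator_add (fun m => conj (w m))]
  ring

variable {τ}

theorem integrable_fourth_monomial (hτ : ∀ m, 0 < τ m) (a b c d : Fin 4) :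
    Integrable (fun w => conj (w a) * w b * (conj (w c) * w d)) (gaussianPi τ) := by
  simp_rw [fourth_monomial_eq_prod]
  exact Integrable.fintype_prod_dep (𝕜 := ℂ) fun m =>
    integrable_complexGaussian_pow_mul_conj_pow (hτ m) _ _

theorem integral_fourth_monomial (hτ : ∀ m, 0 < τ m) (a b c d : Fin 4) :
    ∫ w, conj (w a) * w b * (conj (w c) * w d) ∂gaussianPi τ =
      ((if a = b then 1 else 0) * (if c = d then 1 else 0) +
        (if a = d then 1 else 0) * (if c = b then 1 else 0)) * ((τ b : ℂ) ^ 2 * (τ d : ℂ) ^ 2) := by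
  simp_rw [fourth_monomial_eq_prod]
  rw [integral_fintype_prod_eq_prod (𝕜 := ℂ) (fun m w =>
      w ^ ((if m = b then 1 else 0) + if m = d then 1 else 0) *
        conj w ^ ((if m = a then 1 else 0) + if m = c then 1 else 0))]
  simp_rw [integral_complexGaussian_pow_mul_conj_pow (hτ _)]
  -- Each coordinate contributes `n!` if it occurs equally often with and without conjugation, and
  -- zero otherwise. That the product counts the two Wick pairings is a finite check over all index
  -- patterns.
  have h : ∀ a b c d : Fin 4,
      ∏ m : Fin 4, (if ((if m = b then 1 else 0) + if m = d then 1 else 0) =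
          ((if m = a then 1 else 0) + if m = c then 1 else 0)
        then Nat.factorial ((if m = b then 1 else 0) + if m = d then 1 else 0) else 0) =
      (if a = b then 1 else 0) * (if c = d then 1 else 0) +
        (if a = d then 1 else 0) * (if c = b then 1 else 0) := by
    decide
  have h' := congrArg (Nat.cast : ℕ → ℂ) (h a b c d)
  push_cast at h'
  rw [← h', mul_comm ((τ b : ℂ) ^ 2), ← mul_comm ((τ b : ℂ) ^ 2),
    ← prod_pow_indicator_add (fun m => (τ m : ℂ) ^ 2), ← Finset.prod_mul_distrib]
  refine Finset.prod_congr rfl fun m _ => ?_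
  rw [ite_mul, zero_mul, ← pow_mul]

theorem second_monomial_eq_prod (w : Fin 4 → ℂ) (a b : Fin 4) :
    conj (w a) * w b = ∏ m, (w m ^ (if m = b then 1 else 0) *
        conj (w m) ^ (if m = a then 1 else 0)) := by
  rw [Finset.prod_mul_distrib]
  simp [pow_ite, mul_comm]

theorem integrable_second_monomial (hτ : ∀ m, 0 < τ m) (a b : Fin 4) :
    Integrable (fun w => conj (w a) * w b) (gaussianPi τ) := by
  simp_rw [second_monomial_eq_prod]
  exact Integrable.fintype_prod_dep (𝕜 := ℂ) fun m =>
    integrable_complexGaussian_pow_mul_conj_pow (hτ m) _ _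

theorem integral_second_monomial (hτ : ∀ m, 0 < τ m) (a b : Fin 4) :
    ∫ w, conj (w a) * w b ∂gaussianPi τ = (if a = b then 1 else 0) * (τ b : ℂ) ^ 2 := by
  simp_rw [second_monomial_eq_prod]
  rw [integral_fintype_prod_eq_prod (𝕜 := ℂ) (fun m w =>
      w ^ (if m = b then 1 else 0) * conj w ^ (if m = a then 1 else 0))]
  simp_rw [integral_complexGaussian_pow_mul_conj_pow (hτ _)]
  have h : ∀ a b : Fin 4,
      ∏ m : Fin 4, (if (if m = b then 1 else 0) = (if m = a then 1 else 0)
        then Nat.factorial (if m = b then 1 else 0) else 0) = (if a = b then 1 else 0) := by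
    decide
  have h' := congrArg (Nat.cast : ℕ → ℂ) (h a b)
  push_cast at h'
  have h2 : (τ b : ℂ) ^ 2 = ∏ m, ((τ m : ℂ) ^ 2) ^ (if m = b then 1 else 0) := by simp [pow_ite]
  rw [← h', h2, ← Finset.prod_mul_distrib]
  refine Finset.prod_congr rfl fun m _ => ?_
  rw [ite_mul, zero_mul, ← pow_mul]

/-- The variances of the coordinates, as a diagonal matrix. -/
noncomputable def varianceMatrix (τ : Fin 4 → ℝ) : Matrix (Fin 4) (Fin 4) ℂ :=
  Matrix.diagonal fun m => (τ m : ℂ) ^ 2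

theorem star_dotProduct_mulVec_eq_sum {n : Type*} [Fintype n] (B : Matrix n n ℂ) (w : n → ℂ) :
    star w ⬝ᵥ (B *ᵥ w) = ∑ a, ∑ b, B a b * (conj (w a) * w b) := by
  simp only [dotProduct, Matrix.mulVec, Pi.star_apply, Finset.mul_sum]
  refine Finset.sum_congr rfl fun a _ => Finset.sum_congr rfl fun b _ => ?_
  rw [RCLike.star_def]
  ring

theorem quadratic_mul_eq_sum {n : Type*} [Fintype n] (B C : Matrix n n ℂ) (w : n → ℂ) :
    (star w ⬝ᵥ (B *ᵥ w)) * (star w ⬝ᵥ (C *ᵥ w)) =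
      ∑ a, ∑ b, ∑ c, ∑ d, B a b * C c d * (conj (w a) * w b * (conj (w c) * w d)) := by
  simp_rw [star_dotProduct_mulVec_eq_sum, Finset.sum_mul, Finset.mul_sum]
  refine Finset.sum_congr rfl fun a _ => Finset.sum_congr rfl fun b _ =>
    Finset.sum_congr rfl fun c _ => Finset.sum_congr rfl fun d _ => ?_
  ring

theorem integrable_quadratic (hτ : ∀ m, 0 < τ m) (B : Matrix (Fin 4) (Fin 4) ℂ) :
    Integrable (fun w => star w ⬝ᵥ (B *ᵥ w)) (gaussianPi τ) := by
  simp_rw [star_dotProduct_mulVec_eq_sum]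
  exact integrable_finsetSum _ fun a _ => integrable_finsetSum _ fun b _ =>
    (integrable_second_monomial hτ a b).const_mul _

theorem integral_quadratic (hτ : ∀ m, 0 < τ m) (B : Matrix (Fin 4) (Fin 4) ℂ) :
    ∫ w, star w ⬝ᵥ (B *ᵥ w) ∂gaussianPi τ = (B * varianceMatrix τ).trace := by
  have hi := fun a b => (integrable_second_monomial hτ a b).const_mul (B a b)
  simp_rw [star_dotProduct_mulVec_eq_sum]
  rw [integral_finsetSum _ fun a _ => integrable_finsetSum _ fun b _ => hi a b]
  simp_rw [integral_finsetSum _ fun b _ => hi _ b, integral_const_mul, integral_second_monomial hτ]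
  simp [Matrix.trace, varianceMatrix, Matrix.mul_diagonal]

theorem integrable_quadratic_mul (hτ : ∀ m, 0 < τ m) (B C : Matrix (Fin 4) (Fin 4) ℂ) :
    Integrable (fun w => (star w ⬝ᵥ (B *ᵥ w)) * (star w ⬝ᵥ (C *ᵥ w))) (gaussianPi τ) := by
  simp_rw [quadratic_mul_eq_sum]
  exact integrable_finsetSum _ fun a _ => integrable_finsetSum _ fun b _ =>
    integrable_finsetSum _ fun c _ => integrable_finsetSum _ fun d _ =>
    (integrable_fourth_monomial hτ a b c d).const_mul _

/-- Pairing each conjugated factor with the plain factor of its own form gives the product of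
traces; pairing across the two forms gives the trace of the product. -/
theorem integral_quadratic_mul (hτ : ∀ m, 0 < τ m) (B C : Matrix (Fin 4) (Fin 4) ℂ) :
    ∫ w, (star w ⬝ᵥ (B *ᵥ w)) * (star w ⬝ᵥ (C *ᵥ w)) ∂gaussianPi τ =
      (B * varianceMatrix τ).trace * (C * varianceMatrix τ).trace +
        (B * varianceMatrix τ * (C * varianceMatrix τ)).trace := by
  have hi := fun a b c d => (integrable_fourth_monomial hτ a b c d).const_mul (B a b * C c d)
  simp_rw [quadratic_mul_eq_sum]
  rw [integral_finsetSum _ fun a _ => integrable_finsetSum _ fun b _ =>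
    integrable_finsetSum _ fun c _ => integrable_finsetSum _ fun d _ => hi a b c d]
  simp_rw [integral_finsetSum _ fun b _ => integrable_finsetSum _ fun c _ =>
    integrable_finsetSum _ fun d _ => hi _ b c d]
  simp_rw [integral_finsetSum _ fun c _ => integrable_finsetSum _ fun d _ => hi _ _ c d]
  simp_rw [integral_finsetSum _ fun d _ => hi _ _ _ d, integral_const_mul,
    integral_fourth_monomial hτ, add_mul, mul_add, Finset.sum_add_distrib]
  congr 1
  · simp [Matrix.trace, varianceMatrix, Matrix.mul_diagonal, Finset.sum_mul_sum, mul_ite, ite_mul]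
    refine Finset.sum_congr rfl fun a _ => Finset.sum_congr rfl fun b _ => ?_
    ring
  · simp [Matrix.trace, varianceMatrix, Matrix.mul_apply, Matrix.diagonal_apply, mul_ite, ite_mul]
    refine Finset.sum_congr rfl fun a _ => Finset.sum_congr rfl fun b _ => ?_
    ring

end Wick
end BeamTracking

/-! ### Rank-one algebra of the covariance and smoothness in the direction. -/

namespace BeamTracking

open scoped ComplexConjugate

variable {M N : ℕ}

theorem star_dotProduct_self_eq (g : Fin 3 → ℂ) : star g ⬝ᵥ g = ((∑ i, ‖g i‖ ^ 2 : ℝ) : ℂ) := by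
  simp [dotProduct, ← Complex.normSq_eq_norm_sq, Complex.normSq_eq_conj_mul_self]

theorem star_dotProduct_conj {n : Type*} [Fintype n] (u v : n → ℂ) :
    conj (star u ⬝ᵥ v) = star v ⬝ᵥ u := by
  simp [dotProduct, mul_comm]

theorem star_dotProduct_vecMulVec_mulVec {n : Type*} [Fintype n] (u a b v : n → ℂ) :
    star u ⬝ᵥ (Matrix.vecMulVec a (star b) *ᵥ v) = (star u ⬝ᵥ a) * (star b ⬝ᵥ v) := by
  rw [Matrix.vecMulVec_mulVec, dotProduct_smul]
  simp

/-- The determinant of a rank-one perturbation of a scalar matrix. -/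
theorem det_smul_vecMulVec_add (c s : ℂ) (g : Fin 3 → ℂ) :
    (c • Matrix.vecMulVec g (star g) + s • (1 : Matrix (Fin 3) (Fin 3) ℂ)).det =
      s ^ 2 * (s + c * (star g ⬝ᵥ g)) := by
  simp [Matrix.det_fin_three, Matrix.vecMulVec_apply, dotProduct, Fin.sum_univ_three]
  ring

/-- This is the Sherman–Morrison formula; it rests on `P² = |g|²P` for `P = g gᴴ`. -/
theorem inv_smul_vecMulVec_add {c s : ℂ} (g : Fin 3 → ℂ) (hs : s ≠ 0)
    (hD : s + c * (star g ⬝ᵥ g) ≠ 0) :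
    (c • Matrix.vecMulVec g (star g) + s • (1 : Matrix (Fin 3) (Fin 3) ℂ))⁻¹ =
      s⁻¹ • (1 - (c / (s + c * (star g ⬝ᵥ g))) • Matrix.vecMulVec g (star g)) := by
  apply Matrix.inv_eq_right_inv
  have hP : Matrix.vecMulVec g (star g) * Matrix.vecMulVec g (star g) =
      (star g ⬝ᵥ g) • Matrix.vecMulVec g (star g) := by
    rw [Matrix.vecMulVec_mul_vecMulVec, Matrix.vecMulVec_smul]
  set P := Matrix.vecMulVec g (star g)
  set n := star g ⬝ᵥ g
  simp only [mul_smul_comm, add_mul, mul_sub, smul_mul_assoc, hP, mul_one, one_mul, smul_smul,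
    smul_add, smul_sub]
  match_scalars
  · field_simp
    ring
  · field_simp

/-- `D = σ_z² + |s|²σ_β²|g|²`, the largest eigenvalue of the covariance matrix. -/
noncomputable def topEig (S σβ σz : ℝ) (W : Matrix (Fin M × Fin N) (Fin 3) ℂ)
    (x : EuclideanSpace ℝ (Fin 2)) : ℝ :=
  σz ^ 2 + S ^ 2 * σβ ^ 2 * gSq W x

/-- `∂g/∂x_p`. -/
noncomputable def gDeriv (W : Matrix (Fin M × Fin N) (Fin 3) ℂ) (x : EuclideanSpace ℝ (Fin 2))
    (p : Fin 2) : Fin 3 → ℂ :=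
  fun i => partialD (fun x' => gVec W x' i) p x

/-- The Hermitian matrix of the quadratic part of the score. -/
noncomputable def scoreMat (S σβ σz : ℝ) (W : Matrix (Fin M × Fin N) (Fin 3) ℂ)
    (x : EuclideanSpace ℝ (Fin 2)) (p : Fin 2) : Matrix (Fin 3) (Fin 3) ℂ :=
  ((S ^ 2 * σβ ^ 2 / (σz ^ 2 * topEig S σβ σz W x) : ℝ) : ℂ) •
    (gMat W x p - ((S ^ 2 * σβ ^ 2 * gTilde W x p / topEig S σβ σz W x : ℝ) : ℂ) • gOuter W x)

section Smooth

variable (W : Matrix (Fin M × Fin N) (Fin 3) ℂ)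

theorem contDiff_steering (q : Fin M × Fin N) :
    ContDiff ℝ 1 fun x => steering M N x q := by
  unfold steering steering₁
  have h (i : Fin 2) : ContDiff ℝ 1 fun x : EuclideanSpace ℝ (Fin 2) => x i :=
    (EuclideanSpace.proj i : EuclideanSpace ℝ (Fin 2) →L[ℝ] ℝ).contDiff
  have h0 := h 0
  have h1 := h 1
  have hc : ContDiff ℝ 1 ((↑) : ℝ → ℂ) := Complex.ofRealCLM.contDiff
  refine ContDiff.mul ?_ ?_ <;> refine Complex.contDiff_exp.comp ?_
  · exact contDiff_const.mul (hc.comp (contDiff_const.mul h0))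
  · exact contDiff_const.mul (hc.comp (contDiff_const.mul h1))

theorem contDiff_gVec (i : Fin 3) : ContDiff ℝ 1 fun x => gVec W x i := by
  unfold gVec Matrix.mulVec dotProduct
  exact ContDiff.sum fun q _ => contDiff_const.mul (contDiff_steering q)

theorem contDiff_gOuter (i j : Fin 3) : ContDiff ℝ 1 fun x => gOuter W x i j := by
  unfold gOuter
  simp only [Matrix.vecMulVec_apply, Pi.star_apply]
  exact (contDiff_gVec W i).mul (Complex.conjCLE.contDiff.comp (contDiff_gVec W j))

theorem contDiff_gSq : ContDiff ℝ 1 (gSq W) := by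
  unfold gSq
  exact ContDiff.sum fun i _ => (contDiff_gVec W i).norm_sq ℝ

/-- The derivative is needed at every `t`, not only at `0`: differentiation under the integral uses
the score at all nearby points of the line. -/
theorem hasDerivAt_line {E : Type*} [NormedAddCommGroup E] [NormedSpace ℝ E]
    {f : EuclideanSpace ℝ (Fin 2) → E} (hf : Differentiable ℝ f) (x : EuclideanSpace ℝ (Fin 2))
    (p : Fin 2) (t : ℝ) :
    HasDerivAt (fun u : ℝ => f (x + u • EuclideanSpace.single p (1 : ℝ)))
      (partialD f p (x + t • EuclideanSpace.single p (1 : ℝ))) t := by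
  unfold partialD
  rw [(hf _).lineDeriv_eq_fderiv]
  have h : HasDerivAt (fun u : ℝ => x + u • EuclideanSpace.single p (1 : ℝ))
      (EuclideanSpace.single p (1 : ℝ)) t := by
    simpa using ((hasDerivAt_id t).smul_const (EuclideanSpace.single p (1 : ℝ))).const_add x
  exact (hf _).hasFDerivAt.comp_hasDerivAt t h

theorem hasDerivAt_line_zero {E : Type*} [NormedAddCommGroup E] [NormedSpace ℝ E]
    {f : EuclideanSpace ℝ (Fin 2) → E} (hf : Differentiable ℝ f) (x : EuclideanSpace ℝ (Fin 2))
    (p : Fin 2) :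
    HasDerivAt (fun u : ℝ => f (x + u • EuclideanSpace.single p (1 : ℝ))) (partialD f p x) 0 := by
  simpa using hasDerivAt_line hf x p 0

theorem partialD_eq {E : Type*} [NormedAddCommGroup E] [NormedSpace ℝ E]
    {f : EuclideanSpace ℝ (Fin 2) → E} {x : EuclideanSpace ℝ (Fin 2)} {p : Fin 2} {f' : E}
    (h : HasDerivAt (fun u : ℝ => f (x + u • EuclideanSpace.single p (1 : ℝ))) f' 0) :
    partialD f p x = f' :=
  HasLineDerivAt.lineDeriv h

theorem continuous_partialD {E : Type*} [NormedAddCommGroup E] [NormedSpace ℝ E]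
    {f : EuclideanSpace ℝ (Fin 2) → E} (hf : ContDiff ℝ 1 f) (p : Fin 2) :
    Continuous (partialD f p) := by
  have : partialD f p = fun x => fderiv ℝ f x (EuclideanSpace.single p (1 : ℝ)) :=
    funext fun x => (hf.differentiable one_ne_zero x).lineDeriv_eq_fderiv
  rw [this]
  exact (hf.continuous_fderiv one_ne_zero).clm_apply continuous_const

theorem gMat_eq (x : EuclideanSpace ℝ (Fin 2)) (p : Fin 2) :
    gMat W x p = Matrix.vecMulVec (gDeriv W x p) (star (gVec W x)) +
      Matrix.vecMulVec (gVec W x) (star (gDeriv W x p)) := by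
  ext i j
  have h (i) := hasDerivAt_line_zero ((contDiff_gVec W i).differentiable one_ne_zero) x p
  have := partialD_eq (f := fun x' => gOuter W x' i j) ((h i).mul (h j).star)
  rw [gMat, Matrix.of_apply, this]
  simp [Matrix.vecMulVec_apply, gDeriv]

theorem gTilde_eq (x : EuclideanSpace ℝ (Fin 2)) (p : Fin 2) :
    (gTilde W x p : ℂ) = star (gVec W x) ⬝ᵥ gDeriv W x p + star (gDeriv W x p) ⬝ᵥ gVec W x := by
  have h (i) := hasDerivAt_line_zero ((contDiff_gVec W i).differentiable one_ne_zero) x p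
  have := partialD_eq (f := gSq W) (x := x) (p := p)
    (HasDerivAt.fun_sum fun i _ => (h i).norm_sq)
  rw [gTilde, this, Complex.ofReal_sum, dotProduct, dotProduct, ← Finset.sum_add_distrib]
  refine Finset.sum_congr rfl fun i _ => ?_
  simp only [zero_smul, add_zero, Complex.inner, Pi.star_apply, RCLike.star_def]
  apply Complex.ext <;> simp [gDeriv] <;> ring

theorem gSq_nonneg (x : EuclideanSpace ℝ (Fin 2)) : 0 ≤ gSq W x := by
  unfold gSq; positivity

end Smooth

/-! ### The density in closed form, its score and its Gaussian decay. -/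

section Density

variable {S σβ σz : ℝ} (W : Matrix (Fin M × Fin N) (Fin 3) ℂ)

theorem topEig_pos (S σβ : ℝ) (hσz : 0 < σz) (x : EuclideanSpace ℝ (Fin 2)) :
    0 < topEig S σβ σz W x := by
  have := gSq_nonneg W x
  unfold topEig; positivity

theorem covDI_det (x : EuclideanSpace ℝ (Fin 2)) :
    (covDI S σβ σz W x).det = ((σz ^ 4 * topEig S σβ σz W x : ℝ) : ℂ) := by
  rw [covDI, gOuter, det_smul_vecMulVec_add, star_dotProduct_self_eq, topEig, gSq]
  push_cast
  ring

theorem covDI_inv (S σβ : ℝ) (hσz : 0 < σz) (x : EuclideanSpace ℝ (Fin 2)) :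
    (covDI S σβ σz W x)⁻¹ = ((σz ^ 2 : ℝ) : ℂ)⁻¹ •
      (1 - ((S ^ 2 * σβ ^ 2 / topEig S σβ σz W x : ℝ) : ℂ) • gOuter W x) := by
  have hD : ((σz ^ 2 : ℝ) : ℂ) + ((S ^ 2 * σβ ^ 2 : ℝ) : ℂ) * (star (gVec W x) ⬝ᵥ gVec W x) =
      (topEig S σβ σz W x : ℂ) := by
    rw [star_dotProduct_self_eq, topEig, gSq]
    push_cast
    ring
  rw [covDI, gOuter, inv_smul_vecMulVec_add, hD, Complex.ofReal_div]
  · exact_mod_cast (pow_pos hσz 2).ne'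
  · rw [hD]
    exact_mod_cast (topEig_pos W S σβ hσz x).ne'

/-- `Re yᴴ A y`. -/
noncomputable def quadForm (A : Matrix (Fin 3) (Fin 3) ℂ) (y : Fin 3 → ℂ) : ℝ :=
  (star y ⬝ᵥ (A *ᵥ y)).re

theorem quadForm_eq_sum (A : Matrix (Fin 3) (Fin 3) ℂ) (y : Fin 3 → ℂ) :
    quadForm A y = ∑ a, ∑ b, (A a b * (conj (y a) * y b)).re := by
  simp_rw [quadForm, star_dotProduct_mulVec_eq_sum, Complex.re_sum]

theorem quadForm_sub (A B : Matrix (Fin 3) (Fin 3) ℂ) (y : Fin 3 → ℂ) :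
    quadForm (A - B) y = quadForm A y - quadForm B y := by
  simp [quadForm, Matrix.sub_mulVec, dotProduct_sub]

theorem quadForm_smul (r : ℝ) (A : Matrix (Fin 3) (Fin 3) ℂ) (y : Fin 3 → ℂ) :
    quadForm ((r : ℂ) • A) y = r * quadForm A y := by
  simp [quadForm, Matrix.smul_mulVec, dotProduct_smul]

theorem quadForm_one (y : Fin 3 → ℂ) : quadForm 1 y = ∑ i, ‖y i‖ ^ 2 := by
  rw [quadForm, Matrix.one_mulVec, star_dotProduct_self_eq, Complex.ofReal_re]

theorem quadForm_gOuter (x : EuclideanSpace ℝ (Fin 2)) (y : Fin 3 → ℂ) :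
    quadForm (gOuter W x) y = ‖star (gVec W x) ⬝ᵥ y‖ ^ 2 := by
  rw [quadForm, gOuter, star_dotProduct_vecMulVec_mulVec, ← star_dotProduct_conj, mul_comm,
    Complex.mul_conj, Complex.normSq_eq_norm_sq, Complex.ofReal_re]

/-- A crude bound, from `|y_a||y_b| ≤ ∑ |y_i|²`. It makes the score grow at most quadratically, with
a coefficient that is continuous in the direction. -/
theorem abs_quadForm_le (A : Matrix (Fin 3) (Fin 3) ℂ) (y : Fin 3 → ℂ) :
    |quadForm A y| ≤ (∑ a, ∑ b, ‖A a b‖) * ∑ i, ‖y i‖ ^ 2 := by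
  rw [quadForm_eq_sum, Finset.sum_mul]
  refine (Finset.abs_sum_le_sum_abs _ _).trans (Finset.sum_le_sum fun a _ => ?_)
  rw [Finset.sum_mul]
  refine (Finset.abs_sum_le_sum_abs _ _).trans (Finset.sum_le_sum fun b _ => ?_)
  refine (Complex.abs_re_le_norm _).trans ?_
  rw [norm_mul, norm_mul, RCLike.norm_conj]
  refine mul_le_mul_of_nonneg_left ?_ (norm_nonneg _)
  have h (i) : ‖y i‖ ^ 2 ≤ ∑ i, ‖y i‖ ^ 2 :=
    Finset.single_le_sum (f := fun i => ‖y i‖ ^ 2) (fun i _ => by positivity) (Finset.mem_univ i)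
  nlinarith [h a, h b, sq_nonneg (‖y a‖ - ‖y b‖)]

@[fun_prop]
theorem continuous_quadForm (A : Matrix (Fin 3) (Fin 3) ℂ) : Continuous (quadForm A) := by
  unfold quadForm
  simp_rw [star_dotProduct_mulVec_eq_sum]
  fun_prop

theorem norm_star_dotProduct_sq_le (g y : Fin 3 → ℂ) :
    ‖star g ⬝ᵥ y‖ ^ 2 ≤ (∑ i, ‖g i‖ ^ 2) * ∑ i, ‖y i‖ ^ 2 := by
  refine le_trans (pow_le_pow_left₀ (norm_nonneg _) ?_ 2)
    (Finset.sum_mul_sq_le_sq_mul_sq Finset.univ (fun i => ‖g i‖) fun i => ‖y i‖)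
  refine (norm_sum_le _ _).trans (Finset.sum_le_sum fun i _ => ?_)
  simp

/-- The density, in terms of `D` and `g gᴴ`. -/
theorem pDI_eq (S σβ : ℝ) (hσz : 0 < σz) (x : EuclideanSpace ℝ (Fin 2)) (y : Fin 3 → ℂ) :
    pDI S σβ σz W x y = 1 / (Real.pi ^ 3 * (σz ^ 4 * topEig S σβ σz W x)) *
      Real.exp (-((σz ^ 2)⁻¹ * ((∑ i, ‖y i‖ ^ 2) -
        S ^ 2 * σβ ^ 2 * quadForm (gOuter W x) y / topEig S σβ σz W x))) := by
  have hq : (star y ⬝ᵥ ((covDI S σβ σz W x)⁻¹ *ᵥ y)).re = (σz ^ 2)⁻¹ * ((∑ i, ‖y i‖ ^ 2) -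
        S ^ 2 * σβ ^ 2 * quadForm (gOuter W x) y / topEig S σβ σz W x) := by
    change quadForm _ _ = _
    rw [covDI_inv W S σβ hσz, ← Complex.ofReal_inv, quadForm_smul, quadForm_sub, quadForm_smul,
      quadForm_one]
    ring
  rw [pDI, hq, covDI_det, Complex.ofReal_re]

/-- The logarithm of the density, in terms of `D` and `g gᴴ`. -/
theorem log_pDI (S σβ : ℝ) (hσz : 0 < σz) (x : EuclideanSpace ℝ (Fin 2)) (y : Fin 3 → ℂ) :
    Real.log (pDI S σβ σz W x y) = -Real.log (Real.pi ^ 3 * σz ^ 4) -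
      Real.log (topEig S σβ σz W x) - (σz ^ 2)⁻¹ * ((∑ i, ‖y i‖ ^ 2) -
        S ^ 2 * σβ ^ 2 * quadForm (gOuter W x) y / topEig S σβ σz W x) := by
  have hD := topEig_pos W S σβ hσz x
  have hpi := Real.pi_pos
  rw [pDI_eq W S σβ hσz, Real.log_mul (by positivity) (by positivity),
    Real.log_exp, one_div, Real.log_inv, ← mul_assoc, Real.log_mul (by positivity) hD.ne']
  ring

theorem pDI_pos (S σβ : ℝ) (hσz : 0 < σz) (x : EuclideanSpace ℝ (Fin 2)) (y : Fin 3 → ℂ) :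
    0 < pDI S σβ σz W x y := by
  have hD := topEig_pos W S σβ hσz x
  have hpi := Real.pi_pos
  rw [pDI, covDI_det, Complex.ofReal_re]
  positivity

theorem continuous_pDI (x : EuclideanSpace ℝ (Fin 2)) : Continuous (pDI S σβ σz W x) := by
  have := continuous_quadForm (covDI S σβ σz W x)⁻¹
  unfold quadForm at this
  unfold pDI
  fun_prop

theorem contDiff_topEig (S σβ σz : ℝ) : ContDiff ℝ 1 (topEig S σβ σz W) :=
  contDiff_const.add (contDiff_const.mul (contDiff_gSq W))

theorem contDiff_quadForm_gOuter (y : Fin 3 → ℂ) :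
    ContDiff ℝ 1 fun x => quadForm (gOuter W x) y := by
  simp_rw [quadForm_eq_sum]
  exact ContDiff.sum fun a _ => ContDiff.sum fun b _ =>
    Complex.reCLM.contDiff.comp ((contDiff_gOuter W a b).mul contDiff_const)

theorem contDiff_log_pDI (S σβ : ℝ) (hσz : 0 < σz) (y : Fin 3 → ℂ) :
    ContDiff ℝ 1 fun x => Real.log (pDI S σβ σz W x y) := by
  have hD := fun x => (topEig_pos W S σβ hσz x).ne'
  have h1 := contDiff_topEig W S σβ σz
  simp_rw [log_pDI W S σβ hσz]
  exact (contDiff_const.sub (h1.log hD)).sub (contDiff_const.mul (contDiff_const.sub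
    ((contDiff_const.mul (contDiff_quadForm_gOuter W y)).div h1 hD)))

/-- The score is a centred quadratic form of the observation vector. -/
theorem scoreDI_eq (S σβ : ℝ) (hσz : 0 < σz) (x : EuclideanSpace ℝ (Fin 2)) (p : Fin 2)
    (y : Fin 3 → ℂ) :
    scoreDI S σβ σz W x p y = quadForm (scoreMat S σβ σz W x p) y -
      S ^ 2 * σβ ^ 2 * gTilde W x p / topEig S σβ σz W x := by
  have hD := (topEig_pos W S σβ hσz x).ne'
  have hg := hasDerivAt_line_zero ((contDiff_gSq W).differentiable one_ne_zero) x p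
  have hP : HasDerivAt (fun u : ℝ => quadForm (gOuter W (x + u • EuclideanSpace.single p 1)) y)
      (quadForm (gMat W x p) y) 0 := by
    simp_rw [quadForm_eq_sum]
    refine HasDerivAt.fun_sum fun a _ => HasDerivAt.fun_sum fun b _ => ?_
    have := hasDerivAt_line_zero ((contDiff_gOuter W a b).differentiable one_ne_zero) x p
    exact Complex.reCLM.hasFDerivAt.comp_hasDerivAt 0 (this.mul_const _)
  have hT : HasDerivAt (fun u : ℝ => topEig S σβ σz W (x + u • EuclideanSpace.single p 1))
      (S ^ 2 * σβ ^ 2 * gTilde W x p) 0 := (hg.const_mul _).const_add _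
  have hz : topEig S σβ σz W (x + (0 : ℝ) • EuclideanSpace.single p (1 : ℝ)) ≠ 0 := by simpa using hD
  rw [scoreDI]
  have := partialD_eq (f := fun x' => Real.log (pDI S σβ σz W x' y)) (x := x) (p := p) (by
    simp_rw [log_pDI W S σβ hσz]
    exact ((hT.log hz).const_sub _).sub ((((hP.const_mul (S ^ 2 * σβ ^ 2)).div hT hz).const_sub
      (∑ i, ‖y i‖ ^ 2)).const_mul ((σz ^ 2)⁻¹)))
  rw [this, scoreMat, quadForm_smul, quadForm_sub, quadForm_smul]
  simp only [zero_smul, add_zero]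
  field_simp
  ring

theorem continuous_scoreMat (S σβ : ℝ) (hσz : 0 < σz) (p : Fin 2) (a b : Fin 3) :
    Continuous fun x => scoreMat S σβ σz W x p a b := by
  have hD := fun x => (topEig_pos W S σβ hσz x).ne'
  have h1 := (contDiff_topEig W S σβ σz).continuous
  have h2 : Continuous fun x => gMat W x p a b := continuous_partialD (contDiff_gOuter W a b) p
  have h3 : Continuous fun x => gTilde W x p := continuous_partialD (contDiff_gSq W) p
  have h4 := (contDiff_gOuter W a b).continuous
  simp only [scoreMat, Matrix.smul_apply, Matrix.sub_apply, smul_eq_mul]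
  refine (Complex.continuous_ofReal.comp (continuous_const.div (continuous_const.mul h1)
    fun x => ?_)).mul (h2.sub ((Complex.continuous_ofReal.comp
      ((continuous_const.mul h3).div h1 hD)).mul h4))
  exact mul_ne_zero (pow_pos hσz 2).ne' (hD x)

theorem continuous_gTilde_div_topEig (S σβ : ℝ) (hσz : 0 < σz) (p : Fin 2) :
    Continuous fun x => S ^ 2 * σβ ^ 2 * gTilde W x p / topEig S σβ σz W x :=
  (continuous_const.mul (continuous_partialD (contDiff_gSq W) p)).div
    (contDiff_topEig W S σβ σz).continuous fun x => (topEig_pos W S σβ hσz x).ne'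

/-- The density decays like a Gaussian of variance `D`. -/
theorem log_pDI_le (S σβ : ℝ) (hσz : 0 < σz) (x : EuclideanSpace ℝ (Fin 2)) (y : Fin 3 → ℂ) :
    Real.log (pDI S σβ σz W x y) ≤ -Real.log (Real.pi ^ 3 * σz ^ 4) -
      Real.log (topEig S σβ σz W x) - (topEig S σβ σz W x)⁻¹ * ∑ i, ‖y i‖ ^ 2 := by
  have hD := topEig_pos W S σβ hσz x
  rw [log_pDI W S σβ hσz, quadForm_gOuter]
  have h := norm_star_dotProduct_sq_le (gVec W x) y
  have h2 : S ^ 2 * σβ ^ 2 * ‖star (gVec W x) ⬝ᵥ y‖ ^ 2 ≤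
      S ^ 2 * σβ ^ 2 * (gSq W x * ∑ i, ‖y i‖ ^ 2) := mul_le_mul_of_nonneg_left h (by positivity)
  refine sub_le_sub_left ?_ _
  rw [← sub_nonneg]
  -- By `D - c|g|² = σz²`, with `c = S²σβ²`, the gap between the two exponents is a positive
  -- multiple of the Cauchy–Schwarz defect of `gᴴy`.
  have e : (σz ^ 2)⁻¹ * ((∑ i, ‖y i‖ ^ 2) - S ^ 2 * σβ ^ 2 * ‖star (gVec W x) ⬝ᵥ y‖ ^ 2 /
      topEig S σβ σz W x) - (topEig S σβ σz W x)⁻¹ * ∑ i, ‖y i‖ ^ 2 =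
      (S ^ 2 * σβ ^ 2 * (gSq W x * ∑ i, ‖y i‖ ^ 2) -
        S ^ 2 * σβ ^ 2 * ‖star (gVec W x) ⬝ᵥ y‖ ^ 2) * (σz ^ 2)⁻¹ * (topEig S σβ σz W x)⁻¹ := by
    field_simp
    rw [topEig]
    ring
  rw [e]
  have := sub_nonneg.mpr h2
  positivity

end Density
end BeamTracking

/-! ### The law of one observation. -/

namespace BeamTracking

open scoped ComplexConjugate

variable {M N : ℕ}

/-- The standard deviations of the channel gain and of the three noise entries. -/
def deviations (σβ σz : ℝ) : Fin 4 → ℝ := Fin.cons σβ fun _ => σz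

theorem deviations_pos {σβ σz : ℝ} (hσβ : 0 < σβ) (hσz : 0 < σz) (m : Fin 4) :
    0 < deviations σβ σz m := by
  refine Fin.cases ?_ (fun i => ?_) m
  · exact hσβ
  · exact hσz

theorem sum_norm_sub_sq (r : ℝ) (b : ℂ) (g y : Fin 3 → ℂ) :
    ∑ i, ‖y i - ((r : ℂ) * b) * g i‖ ^ 2 = (∑ i, ‖y i‖ ^ 2) -
      2 * r * (conj b * (star g ⬝ᵥ y)).re + r ^ 2 * ‖b‖ ^ 2 * ∑ i, ‖g i‖ ^ 2 := by
  simp only [dotProduct, Fin.sum_univ_three, ← Complex.normSq_eq_norm_sq, Complex.normSq_apply,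
    Pi.star_apply, RCLike.star_def, Complex.sub_re, Complex.sub_im, Complex.mul_re, Complex.mul_im,
    Complex.ofReal_re, Complex.ofReal_im, Complex.conj_re, Complex.conj_im, Complex.add_re,
    Complex.add_im]
  ring

theorem norm_sub_real_mul_sq (r : ℝ) (b u : ℂ) :
    ‖b - r * u‖ ^ 2 = ‖b‖ ^ 2 - 2 * r * (conj b * u).re + r ^ 2 * ‖u‖ ^ 2 := by
  simp only [← Complex.normSq_eq_norm_sq, Complex.normSq_apply, Complex.sub_re, Complex.sub_im,
    Complex.mul_re, Complex.mul_im, Complex.ofReal_re, Complex.ofReal_im, Complex.conj_re,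
    Complex.conj_im]
  ring

variable {S σβ σz : ℝ} (W : Matrix (Fin M × Fin N) (Fin 3) ℂ)

/-- The joint density of gain and observation, after completing the square in the gain. -/
theorem joint_density_eq (hσβ : 0 < σβ) (hσz : 0 < σz) (x : EuclideanSpace ℝ (Fin 2))
    (y : Fin 3 → ℂ) (b : ℂ) :
    -- Given `y`, the gain is complex Gaussian with mean `(Sσβ²/D) gᴴy` and variance `σβ²σz²/D`; the
    -- second factor on the right is that conditional density.
    complexGaussianPDF σβ b * ∏ i, complexGaussianPDF σz (y i - ((S : ℂ) * b) * gVec W x i) =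
      pDI S σβ σz W x y * (topEig S σβ σz W x / (Real.pi * (σβ ^ 2 * σz ^ 2)) *
        Real.exp (-(topEig S σβ σz W x / (σβ ^ 2 * σz ^ 2)) *
          ‖b - ((S * σβ ^ 2 / topEig S σβ σz W x : ℝ) : ℂ) * (star (gVec W x) ⬝ᵥ y)‖ ^ 2)) := by
  have hD := topEig_pos W S σβ hσz x
  have hpi := Real.pi_pos
  simp only [complexGaussianPDF, Finset.prod_div_distrib, ← Real.exp_sum, ← Finset.mul_sum,
    Finset.prod_const, Finset.card_univ, Fintype.card_fin]
  rw [div_mul_div_comm, ← Real.exp_add, sum_norm_sub_sq, norm_sub_real_mul_sq, pDI_eq W S σβ hσz,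
    quadForm_gOuter, mul_mul_mul_comm, ← Real.exp_add]
  have hn : ∑ i, ‖gVec W x i‖ ^ 2 = gSq W x := rfl
  rw [hn]
  set R := (conj b * (star (gVec W x) ⬝ᵥ y)).re
  set Y := ∑ i, ‖y i‖ ^ 2
  set U := ‖star (gVec W x) ⬝ᵥ y‖ ^ 2
  set B := ‖b‖ ^ 2
  rw [div_eq_mul_one_div, mul_comm]
  congr 1
  · field_simp
  · congr 1
    field_simp
    rw [topEig]
    ring

theorem integral_exp_neg_mul_norm_sub_sq {α : ℝ} (hα : 0 < α) (b₀ : ℂ) :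
    ∫ b : ℂ, Real.exp (-α * ‖b - b₀‖ ^ 2) = Real.pi / α := by
  rw [integral_sub_right_eq_self fun b : ℂ => Real.exp (-α * ‖b‖ ^ 2),
    GaussianFourier.integral_rexp_neg_mul_sq_norm hα, Complex.finrank_real_complex]
  norm_num

theorem lintegral_joint_density (hσβ : 0 < σβ) (hσz : 0 < σz) (x : EuclideanSpace ℝ (Fin 2))
    (y : Fin 3 → ℂ) :
    ∫⁻ b, ENNReal.ofReal (complexGaussianPDF σβ b) *
      ENNReal.ofReal (∏ i, complexGaussianPDF σz (y i - ((S : ℂ) * b) * gVec W x i)) =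
      ENNReal.ofReal (pDI S σβ σz W x y) := by
  have hD := topEig_pos W S σβ hσz x
  have hpi := Real.pi_pos
  have hp := pDI_pos W S σβ hσz x y
  have hI := integral_exp_neg_mul_norm_sub_sq
    (div_pos hD (mul_pos (pow_pos hσβ 2) (pow_pos hσz 2)))
    (((S * σβ ^ 2 / topEig S σβ σz W x : ℝ) : ℂ) * (star (gVec W x) ⬝ᵥ y))
  have hint := Integrable.of_integral_ne_zero (hI.trans_ne (by positivity))
  simp_rw [← ENNReal.ofReal_mul (complexGaussianPDF_nonneg _ _), joint_density_eq W hσβ hσz]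
  rw [← ofReal_integral_eq_lintegral_ofReal ((hint.const_mul _).const_mul _)
    (ae_of_all _ fun b => by positivity), integral_const_mul, integral_const_mul, hI]
  congr 1
  field_simp

/-- The observation vector as a function of the gain and the noise. -/
noncomputable def observe (S : ℝ) (W : Matrix (Fin M × Fin N) (Fin 3) ℂ)
    (x : EuclideanSpace ℝ (Fin 2)) (w : Fin 4 → ℂ) : Fin 3 → ℂ :=
  observation S W x (w 0) fun i => w i.succ

theorem observe_apply (x : EuclideanSpace ℝ (Fin 2)) (w : Fin 4 → ℂ) (i : Fin 3) :
    observe S W x w i = ((S : ℂ) * w 0) * gVec W x i + w i.succ := by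
  simp [observe, observation]

@[fun_prop]
theorem continuous_observe (x : EuclideanSpace ℝ (Fin 2)) : Continuous (observe S W x) := by
  refine continuous_pi fun i => ?_
  simp_rw [observe_apply]
  fun_prop

/-- The law of `T b + v` when `b` and `v` are independent with densities `ρ` and `R`. -/
theorem map_prod_withDensity_add {B V : Type*} [MeasurableSpace B] [MeasurableSpace V] [AddGroup V]
    [MeasurableAdd₂ V] [MeasurableNeg V] [MeasurableSub₂ V] (κ : Measure B) [SFinite κ]
    (ν : Measure V) [SFinite ν] [ν.IsAddLeftInvariant] [ν.IsAddRightInvariant]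
    {ρ : B → ℝ≥0∞} {R : V → ℝ≥0∞} {T : B → V} (hρ : Measurable ρ) (hR : Measurable R)
    (hT : Measurable T) [SFinite (ν.withDensity R)] :
    ((κ.withDensity ρ).prod (ν.withDensity R)).map (fun u => u.2 + T u.1) =
      ν.withDensity fun y => ∫⁻ b, ρ b * R (y - T b) ∂κ := by
  have hm : Measurable fun u : B × V => u.2 + T u.1 := by fun_prop
  ext s hs
  have h1 : Measurable (s.indicator (1 : V → ℝ≥0∞)) := measurable_one.indicator hs
  rw [← lintegral_indicator_one hs, lintegral_map h1 hm,
    lintegral_prod (fun u => s.indicator 1 (u.2 + T u.1)) (h1.comp hm).aemeasurable]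
  -- For fixed `b`, translation by `T b` preserves `ν` and moves the shift into the density `R`.
  -- Tonelli then puts the integral over `b` inside.
  have hin (b : B) : ∫⁻ v, s.indicator 1 (v + T b) ∂(ν.withDensity R) =
      ∫⁻ y, R (y - T b) * s.indicator 1 y ∂ν := by
    have hb : Measurable fun v => s.indicator (1 : V → ℝ≥0∞) (v + T b) :=
      h1.comp (hm.comp (measurable_prodMk_left (x := b)))
    rw [lintegral_withDensity_eq_lintegral_mul _ hR hb, ← lintegral_sub_right_eq_self _ (T b)]
    simp
  have hJ : Measurable fun u : B × V => R (u.2 - T u.1) * s.indicator (1 : V → ℝ≥0∞) u.2 := by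
    fun_prop
  have hmul (b : B) := (lintegral_const_mul (μ := ν) (ρ b)
    (hJ.comp (measurable_prodMk_left (x := b)))).symm
  simp only [Function.comp_def] at hmul
  simp only [hin]
  rw [lintegral_withDensity_eq_lintegral_mul _ hρ hJ.lintegral_prod_right']
  simp only [Pi.mul_apply, hmul]
  rw [lintegral_lintegral_swap ((hρ.comp measurable_fst).mul hJ).aemeasurable,
    withDensity_apply _ hs, ← lintegral_indicator hs]
  refine lintegral_congr fun y => ?_
  simp only [← mul_assoc]
  rw [lintegral_mul_const _ (by fun_prop)]
  by_cases hy : y ∈ s <;> simp [hy]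

/-- The observation vector has the density `p_DI`. -/
theorem map_observe (hσβ : 0 < σβ) (hσz : 0 < σz) (x : EuclideanSpace ℝ (Fin 2)) :
    (gaussianPi (deviations σβ σz)).map (observe S W x) =
      volume.withDensity fun y => ENNReal.ofReal (pDI S σβ σz W x y) := by
  have hpi : (Measure.pi fun _ : Fin 3 => complexGaussian σz) =
      volume.withDensity fun v : Fin 3 → ℂ => ENNReal.ofReal (∏ i, complexGaussianPDF σz (v i)) := by
    rw [complexGaussian_eq_withDensity hσz,
      pi_withDensity_ofReal _ (fun _ => complexGaussianPDF σz)
        (fun _ => integrable_complexGaussianPDF hσz) fun _ => complexGaussianPDF_nonneg σz]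
    rfl
  have hmp := measurePreserving_piFinSuccAbove (n := 3)
    (fun m => complexGaussian (deviations σβ σz m)) 0
  let T : ℂ → Fin 3 → ℂ := fun b => ((S : ℂ) * b) • gVec W x
  have hT : Measurable T := by fun_prop
  have hobs : observe S W x = (fun u : ℂ × (Fin 3 → ℂ) => u.2 + T u.1) ∘
      MeasurableEquiv.piFinSuccAbove (fun _ => ℂ) 0 :=
    funext fun w => add_comm _ _
  have hm : Measurable fun u : ℂ × (Fin 3 → ℂ) => u.2 + T u.1 := by fun_prop
  rw [hobs, ← Measure.map_map hm (MeasurableEquiv.measurable _), hmp.map_eq]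
  change ((complexGaussian σβ).prod (Measure.pi fun _ : Fin 3 => complexGaussian σz)).map _ = _
  rw [hpi, complexGaussian_eq_withDensity hσβ,
    map_prod_withDensity_add _ _ (by fun_prop) (by fun_prop) hT]
  congr 1
  funext y
  exact lintegral_joint_density W hσβ hσz x y

end BeamTracking

/-! ### Quadratic forms under the law of the observation. -/

namespace BeamTracking

open scoped ComplexConjugate

variable {M N : ℕ} {S σβ σz : ℝ} (W : Matrix (Fin M × Fin N) (Fin 3) ℂ)

/-- The matrix that maps gain and noise to the observation. -/
noncomputable def channelMatrix (S : ℝ) (W : Matrix (Fin M × Fin N) (Fin 3) ℂ)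
    (x : EuclideanSpace ℝ (Fin 2)) : Matrix (Fin 3) (Fin 4) ℂ :=
  Matrix.of fun i => Fin.cons ((S : ℂ) * gVec W x i) fun j => if i = j then 1 else 0

theorem observe_eq_mulVec (x : EuclideanSpace ℝ (Fin 2)) (w : Fin 4 → ℂ) :
    observe S W x w = channelMatrix S W x *ᵥ w := by
  ext i
  simp only [observe_apply, channelMatrix, Matrix.mulVec, dotProduct, Fin.sum_univ_succ (n := 3),
    Matrix.of_apply, Fin.cons_zero, Fin.cons_succ, ite_mul, one_mul, zero_mul,
    Finset.sum_ite_eq, Finset.mem_univ, if_true]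
  ring

theorem channelMatrix_mul_variance (x : EuclideanSpace ℝ (Fin 2)) :
    channelMatrix S W x * varianceMatrix (deviations σβ σz) * (channelMatrix S W x)ᴴ =
      covDI S σβ σz W x := by
  ext i j
  rw [varianceMatrix, Matrix.mul_apply, Fin.sum_univ_succ]
  simp only [Matrix.mul_diagonal, channelMatrix, deviations, Matrix.conjTranspose_apply,
    Matrix.of_apply, Fin.cons_zero, Fin.cons_succ, covDI, gOuter, Matrix.add_apply,
    Matrix.smul_apply, Matrix.vecMulVec_apply, Matrix.one_apply, smul_eq_mul, Pi.star_apply,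
    RCLike.star_def, map_mul, Complex.conj_ofReal, apply_ite conj, map_one, map_zero]
  simp only [ite_mul, one_mul, zero_mul, mul_ite, mul_one, mul_zero, Finset.sum_ite_eq,
    Finset.mem_univ, if_true]
  push_cast
  split_ifs <;> ring

/-- The law of the observation vector. -/
noncomputable def obsLaw (S σβ σz : ℝ) (W : Matrix (Fin M × Fin N) (Fin 3) ℂ)
    (x : EuclideanSpace ℝ (Fin 2)) : Measure (Fin 3 → ℂ) :=
  volume.withDensity fun y => ENNReal.ofReal (pDI S σβ σz W x y)

/-- Moments are computed on the independent coordinates of gain and noise, so Gaussian vectors with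
correlated entries need no separate treatment. -/
theorem integrable_obsLaw_iff {f : (Fin 3 → ℂ) → ℂ} (hσβ : 0 < σβ) (hσz : 0 < σz)
    (hf : Continuous f) (x : EuclideanSpace ℝ (Fin 2)) :
    Integrable f (obsLaw S σβ σz W x) ↔
      Integrable (fun w => f (channelMatrix S W x *ᵥ w)) (gaussianPi (deviations σβ σz)) := by
  simp_rw [← observe_eq_mulVec]
  rw [obsLaw, ← map_observe W hσβ hσz,
    integrable_map_measure hf.aestronglyMeasurable (by fun_prop)]
  rfl

theorem integral_obsLaw {f : (Fin 3 → ℂ) → ℂ} (hσβ : 0 < σβ) (hσz : 0 < σz)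
    (hf : Continuous f) (x : EuclideanSpace ℝ (Fin 2)) :
    ∫ y, f y ∂obsLaw S σβ σz W x =
      ∫ w, f (channelMatrix S W x *ᵥ w) ∂gaussianPi (deviations σβ σz) := by
  simp_rw [← observe_eq_mulVec]
  rw [obsLaw, ← map_observe W hσβ hσz, integral_map (by fun_prop) hf.aestronglyMeasurable]

theorem isProbabilityMeasure_obsLaw (hσβ : 0 < σβ) (hσz : 0 < σz)
    (x : EuclideanSpace ℝ (Fin 2)) : IsProbabilityMeasure (obsLaw S σβ σz W x) := by
  rw [obsLaw, ← map_observe W hσβ hσz]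
  exact Measure.isProbabilityMeasure_map (by fun_prop)

theorem star_mulVec_dotProduct {m n : Type*} [Fintype m] [Fintype n] (L : Matrix m n ℂ)
    (B : Matrix m m ℂ) (w : n → ℂ) :
    star (L *ᵥ w) ⬝ᵥ (B *ᵥ (L *ᵥ w)) = star w ⬝ᵥ ((Lᴴ * B * L) *ᵥ w) := by
  rw [Matrix.star_mulVec, ← Matrix.dotProduct_mulVec, Matrix.mulVec_mulVec, Matrix.mulVec_mulVec,
    Matrix.mul_assoc]

/-- Cyclicity of the trace assembles `LVLᴴ = Σ`, so the final formulas no longer involve `L` or `V`.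
-/
theorem trace_conjTranspose_mul_variance (x : EuclideanSpace ℝ (Fin 2))
    (B : Matrix (Fin 3) (Fin 3) ℂ) :
    ((channelMatrix S W x)ᴴ * B * channelMatrix S W x *
      varianceMatrix (deviations σβ σz)).trace = (B * covDI S σβ σz W x).trace := by
  rw [← channelMatrix_mul_variance, Matrix.mul_assoc, Matrix.mul_assoc, Matrix.trace_mul_comm,
    Matrix.mul_assoc]

theorem trace_conjTranspose_mul_variance_mul (x : EuclideanSpace ℝ (Fin 2))
    (B C : Matrix (Fin 3) (Fin 3) ℂ) :
    ((channelMatrix S W x)ᴴ * B * channelMatrix S W x * varianceMatrix (deviations σβ σz) *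
      ((channelMatrix S W x)ᴴ * C * channelMatrix S W x *
        varianceMatrix (deviations σβ σz))).trace =
      (B * covDI S σβ σz W x * (C * covDI S σβ σz W x)).trace := by
  simp only [← channelMatrix_mul_variance, Matrix.mul_assoc]
  rw [Matrix.trace_mul_comm]
  simp only [Matrix.mul_assoc]

theorem continuous_quadratic_mul (B C : Matrix (Fin 3) (Fin 3) ℂ) :
    Continuous fun y : Fin 3 → ℂ => (star y ⬝ᵥ (B *ᵥ y)) * (star y ⬝ᵥ (C *ᵥ y)) := by
  simp_rw [star_dotProduct_mulVec_eq_sum]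
  fun_prop

theorem continuous_quadratic (B : Matrix (Fin 3) (Fin 3) ℂ) :
    Continuous fun y : Fin 3 → ℂ => star y ⬝ᵥ (B *ᵥ y) := by
  simp_rw [star_dotProduct_mulVec_eq_sum]
  fun_prop

theorem integrable_obsLaw_quadratic (hσβ : 0 < σβ) (hσz : 0 < σz) (x : EuclideanSpace ℝ (Fin 2))
    (B : Matrix (Fin 3) (Fin 3) ℂ) :
    Integrable (fun y => star y ⬝ᵥ (B *ᵥ y)) (obsLaw S σβ σz W x) := by
  rw [integrable_obsLaw_iff W hσβ hσz (continuous_quadratic B)]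
  simp_rw [star_mulVec_dotProduct]
  exact integrable_quadratic (deviations_pos hσβ hσz) _

theorem integral_obsLaw_quadratic (hσβ : 0 < σβ) (hσz : 0 < σz) (x : EuclideanSpace ℝ (Fin 2))
    (B : Matrix (Fin 3) (Fin 3) ℂ) :
    ∫ y, star y ⬝ᵥ (B *ᵥ y) ∂obsLaw S σβ σz W x = (B * covDI S σβ σz W x).trace := by
  rw [integral_obsLaw W hσβ hσz (continuous_quadratic B)]
  simp_rw [star_mulVec_dotProduct]
  rw [integral_quadratic (deviations_pos hσβ hσz), trace_conjTranspose_mul_variance]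

theorem integrable_obsLaw_quadratic_mul (hσβ : 0 < σβ) (hσz : 0 < σz)
    (x : EuclideanSpace ℝ (Fin 2)) (B C : Matrix (Fin 3) (Fin 3) ℂ) :
    Integrable (fun y => (star y ⬝ᵥ (B *ᵥ y)) * (star y ⬝ᵥ (C *ᵥ y))) (obsLaw S σβ σz W x) := by
  rw [integrable_obsLaw_iff W hσβ hσz (continuous_quadratic_mul B C)]
  simp_rw [star_mulVec_dotProduct]
  exact integrable_quadratic_mul (deviations_pos hσβ hσz) _ _

theorem integral_obsLaw_quadratic_mul (hσβ : 0 < σβ) (hσz : 0 < σz)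
    (x : EuclideanSpace ℝ (Fin 2)) (B C : Matrix (Fin 3) (Fin 3) ℂ) :
    ∫ y, (star y ⬝ᵥ (B *ᵥ y)) * (star y ⬝ᵥ (C *ᵥ y)) ∂obsLaw S σβ σz W x =
      (B * covDI S σβ σz W x).trace * (C * covDI S σβ σz W x).trace +
        (B * covDI S σβ σz W x * (C * covDI S σβ σz W x)).trace := by
  rw [integral_obsLaw W hσβ hσz (continuous_quadratic_mul B C)]
  simp_rw [star_mulVec_dotProduct]
  rw [integral_quadratic_mul (deviations_pos hσβ hσz), trace_conjTranspose_mul_variance,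
    trace_conjTranspose_mul_variance, trace_conjTranspose_mul_variance_mul]

theorem gOuter_isHermitian (x : EuclideanSpace ℝ (Fin 2)) : (gOuter W x).IsHermitian := by
  ext i j
  simp [gOuter, Matrix.vecMulVec_apply, mul_comm]

theorem gMat_isHermitian (x : EuclideanSpace ℝ (Fin 2)) (p : Fin 2) :
    (gMat W x p).IsHermitian := by
  rw [gMat_eq]
  ext i j
  simp [Matrix.vecMulVec_apply, mul_comm, add_comm]

theorem scoreMat_isHermitian (x : EuclideanSpace ℝ (Fin 2)) (p : Fin 2) :
    (scoreMat S σβ σz W x p).IsHermitian := by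
  ext i j
  simp only [scoreMat, Matrix.conjTranspose_apply, Matrix.smul_apply, Matrix.sub_apply,
    smul_eq_mul, star_mul', star_sub, (gMat_isHermitian W x p).apply, (gOuter_isHermitian W x).apply,
    RCLike.star_def, Complex.conj_ofReal]

/-- A Hermitian form takes real values. This lets the real score be evaluated with the complex
moment formulas. -/
theorem ofReal_quadForm {B : Matrix (Fin 3) (Fin 3) ℂ} (hB : B.IsHermitian) (y : Fin 3 → ℂ) :
    (quadForm B y : ℂ) = star y ⬝ᵥ (B *ᵥ y) := by
  rw [quadForm, ← Complex.conj_eq_iff_re, star_dotProduct_conj, Matrix.star_mulVec, hB.eq,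
    Matrix.dotProduct_mulVec]

/-! ### Traces of products of `g gᴴ`, its derivatives and the covariance. -/

section Traces

variable (x : EuclideanSpace ℝ (Fin 2)) (p j : Fin 2)

theorem trace_mul_gOuter (X : Matrix (Fin 3) (Fin 3) ℂ) :
    (X * gOuter W x).trace = star (gVec W x) ⬝ᵥ (X *ᵥ gVec W x) := by
  rw [gOuter, Matrix.mul_vecMulVec, Matrix.trace_vecMulVec, dotProduct_comm]

theorem gSq_eq_dotProduct : (gSq W x : ℂ) = star (gVec W x) ⬝ᵥ gVec W x :=
  (star_dotProduct_self_eq _).symm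

theorem gVec_gMat_gVec : star (gVec W x) ⬝ᵥ (gMat W x p *ᵥ gVec W x) =
    (gSq W x : ℂ) * (gTilde W x p : ℂ) := by
  rw [gMat_eq, Matrix.add_mulVec, dotProduct_add, star_dotProduct_vecMulVec_mulVec,
    star_dotProduct_vecMulVec_mulVec, gTilde_eq, gSq_eq_dotProduct]
  ring

theorem gOuter_mul_mul_gOuter (X : Matrix (Fin 3) (Fin 3) ℂ) :
    gOuter W x * X * gOuter W x = (star (gVec W x) ⬝ᵥ (X *ᵥ gVec W x)) • gOuter W x := by
  rw [gOuter, Matrix.mul_assoc, Matrix.mul_vecMulVec, Matrix.vecMulVec_mul_vecMulVec,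
    Matrix.vecMulVec_smul]

theorem gOuter_mul_gOuter : gOuter W x * gOuter W x = (gSq W x : ℂ) • gOuter W x := by
  simpa [gSq_eq_dotProduct] using gOuter_mul_mul_gOuter W x 1

/-- The vector `g` is an eigenvector of the covariance with eigenvalue `D`, which collapses every
product containing `g gᴴ`. -/
theorem gOuter_mul_covDI :
    gOuter W x * covDI S σβ σz W x = (topEig S σβ σz W x : ℂ) • gOuter W x := by
  rw [covDI, mul_add, mul_smul_comm, mul_smul_comm, mul_one, gOuter_mul_gOuter, smul_smul,
    ← add_smul, topEig]
  congr 1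
  push_cast
  ring

theorem covDI_mul_gOuter :
    covDI S σβ σz W x * gOuter W x = (topEig S σβ σz W x : ℂ) • gOuter W x := by
  rw [← gOuter_mul_covDI, covDI, mul_add, add_mul, mul_smul_comm, mul_smul_comm, smul_mul_assoc,
    smul_mul_assoc, mul_one, one_mul]

theorem trace_gMat_covDI_gOuter : (gMat W x p * covDI S σβ σz W x * gOuter W x).trace =
    (topEig S σβ σz W x : ℂ) * ((gSq W x : ℂ) * gTilde W x p) := by
  rw [Matrix.mul_assoc, covDI_mul_gOuter, mul_smul_comm, Matrix.trace_smul, trace_mul_gOuter,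
    gVec_gMat_gVec, smul_eq_mul]

theorem trace_gOuter_mul_gOuter : (gOuter W x * gOuter W x).trace = (gSq W x : ℂ) ^ 2 := by
  rw [trace_mul_gOuter, gOuter, star_dotProduct_vecMulVec_mulVec, gSq_eq_dotProduct, sq]

theorem scoreMat_mul_covDI (hσz : 0 < σz) : scoreMat S σβ σz W x p * covDI S σβ σz W x =
    ((S ^ 2 * σβ ^ 2 / (σz ^ 2 * topEig S σβ σz W x) : ℝ) : ℂ) •
      (gMat W x p * covDI S σβ σz W x -
        ((S ^ 2 * σβ ^ 2 * gTilde W x p : ℝ) : ℂ) • gOuter W x) := by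
  have hD := (topEig_pos W S σβ hσz x).ne'
  rw [scoreMat, smul_mul_assoc, sub_mul, smul_mul_assoc, gOuter_mul_covDI, smul_smul,
    ← Complex.ofReal_mul, div_mul_cancel₀ _ hD]

theorem trace_gMat_mul_covDI : (gMat W x p * covDI S σβ σz W x).trace =
    (topEig S σβ σz W x : ℂ) * (gTilde W x p : ℂ) := by
  have h1 : (gMat W x p).trace = (gTilde W x p : ℂ) := by
    rw [gMat_eq, Matrix.trace_add, Matrix.trace_vecMulVec, Matrix.trace_vecMulVec, gTilde_eq,
      dotProduct_comm, dotProduct_comm (gVec W x)]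
  rw [covDI, mul_add, mul_smul_comm, mul_smul_comm, mul_one, Matrix.trace_add, Matrix.trace_smul,
    Matrix.trace_smul, trace_mul_gOuter, gVec_gMat_gVec, h1, topEig]
  simp only [smul_eq_mul]
  push_cast
  ring

theorem trace_scoreMat_mul_covDI (hσz : 0 < σz) :
    (scoreMat S σβ σz W x p * covDI S σβ σz W x).trace =
      ((S ^ 2 * σβ ^ 2 * gTilde W x p / topEig S σβ σz W x : ℝ) : ℂ) := by
  have hD := (topEig_pos W S σβ hσz x).ne'
  have hP : (gOuter W x).trace = (gSq W x : ℂ) := by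
    rw [gOuter, Matrix.trace_vecMulVec, dotProduct_comm, gSq_eq_dotProduct]
  rw [scoreMat_mul_covDI W x p hσz, Matrix.trace_smul, Matrix.trace_sub, Matrix.trace_smul,
    trace_gMat_mul_covDI, hP]
  simp only [smul_eq_mul]
  norm_cast
  field_simp
  rw [topEig]
  ring

theorem trace_gMat_covDI_gMat_covDI :
    (gMat W x p * covDI S σβ σz W x * (gMat W x j * covDI S σβ σz W x)).trace =
      ((S ^ 2 * σβ ^ 2 : ℝ) : ℂ) ^ 2 * ((gSq W x : ℂ) ^ 2 * gTilde W x p * gTilde W x j) +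
      ((S ^ 2 * σβ ^ 2 : ℝ) : ℂ) * ((σz ^ 2 : ℝ) : ℂ) * (star (gVec W x) ⬝ᵥ
        ((gMat W x p * gMat W x j + gMat W x j * gMat W x p) *ᵥ gVec W x)) +
      ((σz ^ 2 : ℝ) : ℂ) ^ 2 * (gMat W x p * gMat W x j).trace := by
  have h1 : (gMat W x p * gOuter W x * (gMat W x j * gOuter W x)).trace =
      (gSq W x : ℂ) ^ 2 * gTilde W x p * gTilde W x j := by
    rw [Matrix.mul_assoc, ← Matrix.mul_assoc (gOuter W x), gOuter_mul_mul_gOuter, mul_smul_comm,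
      Matrix.trace_smul, trace_mul_gOuter, gVec_gMat_gVec, gVec_gMat_gVec, smul_eq_mul]
    ring
  have h2 : (gMat W x p * gOuter W x * gMat W x j).trace =
      star (gVec W x) ⬝ᵥ ((gMat W x j * gMat W x p) *ᵥ gVec W x) := by
    rw [Matrix.trace_mul_comm, ← Matrix.mul_assoc, trace_mul_gOuter]
  have h3 : (gMat W x p * (gMat W x j * gOuter W x)).trace =
      star (gVec W x) ⬝ᵥ ((gMat W x p * gMat W x j) *ᵥ gVec W x) := by
    rw [← Matrix.mul_assoc, trace_mul_gOuter]
  rw [covDI]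
  simp only [mul_add, add_mul, mul_smul_comm, smul_mul_assoc, mul_one, Matrix.trace_add,
    Matrix.trace_smul, h1, h2, h3, smul_eq_mul, Matrix.add_mulVec, dotProduct_add]
  ring

theorem trace_scoreMat_mul (hσz : 0 < σz) :
    (scoreMat S σβ σz W x p * covDI S σβ σz W x *
      (scoreMat S σβ σz W x j * covDI S σβ σz W x)).trace =
    ((S ^ 2 * σβ ^ 2 / (σz ^ 2 * topEig S σβ σz W x) : ℝ) : ℂ) ^ 2 *
      (-2 * ((S ^ 2 * σβ ^ 2 : ℝ) : ℂ) * ((σz ^ 2 : ℝ) : ℂ) *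
          ((gSq W x : ℂ) * gTilde W x p * gTilde W x j) +
        ((S ^ 2 * σβ ^ 2 : ℝ) : ℂ) * ((σz ^ 2 : ℝ) : ℂ) * (star (gVec W x) ⬝ᵥ
          ((gMat W x p * gMat W x j + gMat W x j * gMat W x p) *ᵥ gVec W x)) +
        ((σz ^ 2 : ℝ) : ℂ) ^ 2 * (gMat W x p * gMat W x j).trace) := by
  have h1 : (gOuter W x * (gMat W x j * covDI S σβ σz W x)).trace =
      (topEig S σβ σz W x : ℂ) * ((gSq W x : ℂ) * gTilde W x j) := by
    rw [Matrix.trace_mul_comm, trace_gMat_covDI_gOuter]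
  rw [scoreMat_mul_covDI W x p hσz, scoreMat_mul_covDI W x j hσz]
  simp only [mul_sub, sub_mul, mul_smul_comm, smul_mul_assoc, Matrix.trace_sub,
    Matrix.trace_smul, smul_sub, smul_eq_mul, trace_gMat_covDI_gMat_covDI, h1,
    trace_gMat_covDI_gOuter, trace_gOuter_mul_gOuter]
  -- With `c = S²σβ²`, the `g̃_p g̃_j` terms have coefficient `2c²|g|⁴ - 2cD|g|²`; substituting `D =
  -- σz² + c|g|²` leaves `-2cσz²|g|²`.
  rw [topEig]
  push_cast
  ring

end Traces

/-! ### The score and the closed form of the Fisher information. -/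

section Fisher

variable (x : EuclideanSpace ℝ (Fin 2)) (p j : Fin 2)

theorem ofReal_scoreDI (hσz : 0 < σz) (y : Fin 3 → ℂ) :
    (scoreDI S σβ σz W x p y : ℂ) = star y ⬝ᵥ (scoreMat S σβ σz W x p *ᵥ y) -
      (scoreMat S σβ σz W x p * covDI S σβ σz W x).trace := by
  rw [scoreDI_eq W S σβ hσz, Complex.ofReal_sub, ofReal_quadForm (scoreMat_isHermitian W x p),
    trace_scoreMat_mul_covDI W x p hσz]

theorem continuous_scoreDI (hσz : 0 < σz) : Continuous (scoreDI S σβ σz W x p) := by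
  have : scoreDI S σβ σz W x p = _ := funext fun y => scoreDI_eq W S σβ hσz x p y
  rw [this]
  fun_prop

theorem integrable_scoreDI (hσβ : 0 < σβ) (hσz : 0 < σz) :
    Integrable (scoreDI S σβ σz W x p) (obsLaw S σβ σz W x) := by
  have := isProbabilityMeasure_obsLaw (S := S) W hσβ hσz x
  have h : Integrable (fun y => (scoreDI S σβ σz W x p y : ℂ)) (obsLaw S σβ σz W x) := by
    simp_rw [ofReal_scoreDI W x p hσz]
    exact (integrable_obsLaw_quadratic W hσβ hσz x _).sub (integrable_const _)
  exact h.re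

/-- The score is centred. -/
theorem integral_scoreDI (hσβ : 0 < σβ) (hσz : 0 < σz) :
    ∫ y, scoreDI S σβ σz W x p y ∂obsLaw S σβ σz W x = 0 := by
  have := isProbabilityMeasure_obsLaw (S := S) W hσβ hσz x
  rw [← Complex.ofReal_inj, ← integral_complex_ofReal]
  simp_rw [ofReal_scoreDI W x p hσz]
  rw [integral_sub (integrable_obsLaw_quadratic W hσβ hσz x _) (integrable_const _),
    integral_obsLaw_quadratic W hσβ hσz]
  simp

/-- Only one score is expanded in the last term: its integral vanishes because the score is centred.
-/
theorem ofReal_scoreDI_mul (hσz : 0 < σz) (y : Fin 3 → ℂ) :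
    ((scoreDI S σβ σz W x p y * scoreDI S σβ σz W x j y : ℝ) : ℂ) =
      (star y ⬝ᵥ (scoreMat S σβ σz W x p *ᵥ y)) * (star y ⬝ᵥ (scoreMat S σβ σz W x j *ᵥ y)) -
      (scoreMat S σβ σz W x j * covDI S σβ σz W x).trace *
        (star y ⬝ᵥ (scoreMat S σβ σz W x p *ᵥ y)) -
      (scoreMat S σβ σz W x p * covDI S σβ σz W x).trace *
        (scoreDI S σβ σz W x j y : ℂ) := by
  rw [Complex.ofReal_mul, ofReal_scoreDI W x p hσz, ofReal_scoreDI W x j hσz]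
  ring

theorem integrable_scoreDI_mul (hσβ : 0 < σβ) (hσz : 0 < σz) :
    Integrable (fun y => scoreDI S σβ σz W x p y * scoreDI S σβ σz W x j y)
      (obsLaw S σβ σz W x) := by
  have h : Integrable (fun y => ((scoreDI S σβ σz W x p y * scoreDI S σβ σz W x j y : ℝ) : ℂ))
      (obsLaw S σβ σz W x) := by
    simp_rw [ofReal_scoreDI_mul W x p j hσz]
    exact ((integrable_obsLaw_quadratic_mul W hσβ hσz x _ _).sub
      ((integrable_obsLaw_quadratic W hσβ hσz x _).const_mul _)).sub
      ((integrable_scoreDI W x j hσβ hσz).ofReal.const_mul _)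
  exact h.re

theorem integral_scoreDI_mul (hσβ : 0 < σβ) (hσz : 0 < σz) :
    ((∫ y, scoreDI S σβ σz W x p y * scoreDI S σβ σz W x j y ∂obsLaw S σβ σz W x : ℝ) : ℂ) =
      (scoreMat S σβ σz W x p * covDI S σβ σz W x *
        (scoreMat S σβ σz W x j * covDI S σβ σz W x)).trace := by
  have h0 := integral_scoreDI (S := S) W x j hσβ hσz
  rw [← Complex.ofReal_inj, ← integral_complex_ofReal] at h0
  rw [← integral_complex_ofReal]
  simp_rw [ofReal_scoreDI_mul W x p j hσz]
  have h1 := integrable_obsLaw_quadratic_mul (S := S) W hσβ hσz x (scoreMat S σβ σz W x p)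
    (scoreMat S σβ σz W x j)
  have h2 := (integrable_obsLaw_quadratic (S := S) W hσβ hσz x (scoreMat S σβ σz W x p)).const_mul
    (scoreMat S σβ σz W x j * covDI S σβ σz W x).trace
  rw [integral_sub (f := fun y => _ - _) (h1.sub h2)
      ((integrable_scoreDI W x j hσβ hσz).ofReal.const_mul _), integral_sub h1 h2, integral_const_mul, integral_const_mul, h0,
    integral_obsLaw_quadratic W hσβ hσz, integral_obsLaw_quadratic_mul W hσβ hσz]
  simp only [Complex.ofReal_zero]
  ring

theorem integrable_obsLaw_iff_mul_pDI (hσz : 0 < σz) {f : (Fin 3 → ℂ) → ℝ} :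
    Integrable f (obsLaw S σβ σz W x) ↔ Integrable fun y => f y * pDI S σβ σz W x y := by
  rw [obsLaw, integrable_withDensity_iff_integrable_smul'
    (continuous_pDI W x).measurable.ennreal_ofReal (ae_of_all _ fun _ => ENNReal.ofReal_lt_top)]
  refine integrable_congr (ae_of_all _ fun y => ?_)
  simp [ENNReal.toReal_ofReal (pDI_pos W S σβ hσz x y).le, mul_comm]

theorem integral_obsLaw_eq_integral_mul_pDI (hσz : 0 < σz) (f : (Fin 3 → ℂ) → ℝ) :
    ∫ y, f y ∂obsLaw S σβ σz W x = ∫ y, f y * pDI S σβ σz W x y := by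
  rw [obsLaw, integral_withDensity_eq_integral_toReal_smul
    (continuous_pDI W x).measurable.ennreal_ofReal (ae_of_all _ fun _ => ENNReal.ofReal_lt_top)]
  refine integral_congr_ae (ae_of_all _ fun y => ?_)
  simp [ENNReal.toReal_ofReal (pDI_pos W S σβ hσz x y).le, mul_comm]

theorem fisherDI_eq_integral_obsLaw (hσz : 0 < σz) : fisherDI S σβ σz W x p j =
    ∫ y, scoreDI S σβ σz W x p y * scoreDI S σβ σz W x j y ∂obsLaw S σβ σz W x := by
  rw [integral_obsLaw_eq_integral_mul_pDI W x hσz]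
  rfl

theorem fisherDI_eq (hS : 0 < S) (hσβ : 0 < σβ) (hσz : 0 < σz) :
    ((fisherDI S σβ σz W x p j : ℝ) : ℂ) =
      (σz ^ 6 * S ^ 6 * σβ ^ 6 : ℝ) / (covDI S σβ σz W x).det ^ 2 *
        (-2 * (gSq W x : ℂ) * (gTilde W x p : ℂ) * (gTilde W x j : ℂ)
          + ((σz ^ 2 / (S ^ 2 * σβ ^ 2) : ℝ) : ℂ) * (gMat W x p * gMat W x j).trace
          + star (gVec W x) ⬝ᵥ
              ((gMat W x p * gMat W x j + gMat W x j * gMat W x p) *ᵥ gVec W x)) := by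
  have hD : (topEig S σβ σz W x : ℂ) ≠ 0 := by exact_mod_cast (topEig_pos W S σβ hσz x).ne'
  have h1 : (S : ℂ) ≠ 0 := by exact_mod_cast hS.ne'
  have h2 : (σβ : ℂ) ≠ 0 := by exact_mod_cast hσβ.ne'
  have h3 : (σz : ℂ) ≠ 0 := by exact_mod_cast hσz.ne'
  rw [fisherDI_eq_integral_obsLaw W x p j hσz, integral_scoreDI_mul W x p j hσβ hσz,
    trace_scoreMat_mul W x p j hσz, covDI_det]
  push_cast
  field_simp
  ring

end Fisher

end BeamTracking

/-! ### Differentiation under the integral and the abstract Cramér–Rao inequality. -/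

namespace BeamTracking

/-- Differentiation under the integral sign for a family of densities `exp (φ t)` with Gaussian
decay, tested against a function that is square integrable for the density at `t = 0`. -/
theorem hasDerivAt_integral_mul_exp {E : Type*} [MeasurableSpace E] {ν : Measure E}
    {φ φ' : ℝ → E → ℝ} {n F : E → ℝ} {C κ K δ : ℝ} (hδ : 0 < δ) (hC : 0 < C) (hκ : 0 < κ)
    (hφ : ∀ t, Measurable (φ t)) (hφ' : Measurable (φ' 0)) (hn0 : ∀ v, 0 ≤ n v)
    (hF : Measurable F) (hder : ∀ t v, HasDerivAt (φ · v) (φ' t v) t)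
    (hbound : ∀ t, |t| < δ → ∀ v, |φ' t v| ≤ C * (1 + n v))
    (hdecay : ∀ v, φ 0 v ≤ K - κ * n v)
    (hint : ∀ a, 0 < a → Integrable (fun v => Real.exp (-a * n v)) ν)
    (hF2 : Integrable (fun v => F v ^ 2 * Real.exp (φ 0 v)) ν) :
    Integrable (fun v => F v * (Real.exp (φ 0 v) * φ' 0 v)) ν ∧
      HasDerivAt (fun t => ∫ v, F v * Real.exp (φ t v) ∂ν)
        (∫ v, F v * (Real.exp (φ 0 v) * φ' 0 v) ∂ν) 0 := by
  have hK : ∀ v, Real.exp (φ 0 v + κ / 2 * (1 + n v)) ≤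
      Real.exp (K + κ / 2) * Real.exp (-(κ / 2) * n v) := fun v => by
    rw [← Real.exp_add, Real.exp_le_exp]
    linarith [hdecay v]
  have hG := hF2.add ((hint (κ / 2) (half_pos hκ)).const_mul (Real.exp (K + κ / 2)))
  -- By `|F| a ≤ F² + a²` with `a = exp (κ/4 (1 + n))`, square integrability at `t = 0` suffices.
  -- The `a²` term costs `κ/2` of the decay rate `κ`, and the other half keeps it integrable.
  have habs : ∀ v, |F v| * Real.exp (φ 0 v + κ / 4 * (1 + n v)) ≤ F v ^ 2 * Real.exp (φ 0 v) +
      Real.exp (K + κ / 2) * Real.exp (-(κ / 2) * n v) := fun v => by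
    refine le_trans ?_ (add_le_add_right (hK v) _)
    have e : κ / 2 * (1 + n v) = κ / 4 * (1 + n v) + κ / 4 * (1 + n v) := by ring
    rw [e, Real.exp_add, Real.exp_add (φ 0 v), Real.exp_add (κ / 4 * (1 + n v)), ← sq_abs (F v)]
    have h0 := Real.exp_pos (φ 0 v)
    set a := Real.exp (κ / 4 * (1 + n v))
    have : |F v| * a ≤ |F v| ^ 2 + a * a := by
      nlinarith [sq_nonneg (|F v| - a), sq_nonneg (|F v|), sq_nonneg a]
    nlinarith
  have hmeas : ∀ t, AEStronglyMeasurable (fun v => F v * Real.exp (φ t v)) ν := fun t =>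
    (hF.mul (hφ t).exp).aestronglyMeasurable
  have hint0 : Integrable (fun v => F v * Real.exp (φ 0 v)) ν := by
    refine hG.mono' (hmeas 0) (ae_of_all _ fun v => le_trans ?_ (habs v))
    rw [norm_mul, Real.norm_eq_abs, Real.norm_eq_abs, Real.abs_exp]
    refine mul_le_mul_of_nonneg_left (Real.exp_le_exp.mpr ?_) (abs_nonneg _)
    have := hn0 v
    have : 0 ≤ κ / 4 * (1 + n v) := by positivity
    linarith
  -- For `|t| < r` the mean value bound moves `φ` by at most `κ/8 (1 + n)`. A second `κ/8` absorbs
  -- the linear growth of `φ'` into an exponential; together they make the `κ/4` of `habs`.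
  set r := min δ (κ / 8 / C) with hr
  have hr0 : 0 < r := lt_min hδ (by positivity)
  refine hasDerivAt_integral_of_dominated_loc_of_deriv_le (F := fun t v => F v * Real.exp (φ t v))
    (F' := fun t v => F v * (Real.exp (φ t v) * φ' t v))
    (bound := fun v => C / (κ / 8) * (F v ^ 2 * Real.exp (φ 0 v) +
      Real.exp (K + κ / 2) * Real.exp (-(κ / 2) * n v)))
    (Metric.ball_mem_nhds 0 hr0) (Eventually.of_forall hmeas) hint0
    (hF.mul ((hφ 0).exp.mul hφ')).aestronglyMeasurable
    (ae_of_all _ fun v t ht => ?_) (hG.const_mul _)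
    (ae_of_all _ fun v t _ => ((hder t v).exp).const_mul (F v))
  have hn1 : 0 < 1 + n v := by linarith [hn0 v]
  have htr : |t| < r := by simpa using ht
  have hmv : |φ t v - φ 0 v| ≤ C * (1 + n v) * |t - 0| := by
    refine (convex_ball (0 : ℝ) r).norm_image_sub_le_of_norm_hasDerivWithin_le
      (f := fun t => φ t v) (fun u _ => (hder u v).hasDerivWithinAt) (fun u hu => ?_)
      (Metric.mem_ball_self hr0) ht
    exact hbound u ((show |u| < r by simpa using hu).trans_le (min_le_left _ _)) v
  have hCt : C * |t| ≤ κ / 8 := by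
    have := (htr.le.trans (min_le_right _ _))
    rwa [le_div_iff₀ hC, mul_comm] at this
  have h1 : φ t v ≤ φ 0 v + κ / 8 * (1 + n v) := by
    have h := (le_abs_self _).trans hmv
    rw [sub_zero] at h
    nlinarith
  have h2 : |φ' t v| ≤ C / (κ / 8) * Real.exp (κ / 8 * (1 + n v)) := by
    refine (hbound t (htr.trans_le (min_le_left _ _)) v).trans ?_
    have h := (le_add_of_nonneg_right zero_le_one).trans (Real.add_one_le_exp (κ / 8 * (1 + n v)))
    calc C * (1 + n v) = C / (κ / 8) * (κ / 8 * (1 + n v)) := by field_simp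
      _ ≤ _ := mul_le_mul_of_nonneg_left h (by positivity)
  rw [norm_mul, norm_mul, Real.norm_eq_abs, Real.norm_eq_abs, Real.norm_eq_abs, Real.abs_exp]
  calc |F v| * (Real.exp (φ t v) * |φ' t v|)
      ≤ |F v| * (Real.exp (φ 0 v + κ / 8 * (1 + n v)) *
        (C / (κ / 8) * Real.exp (κ / 8 * (1 + n v)))) := by
        gcongr
    _ = C / (κ / 8) * (|F v| * Real.exp (φ 0 v + κ / 4 * (1 + n v))) := by
        have e : κ / 4 * (1 + n v) = κ / 8 * (1 + n v) + κ / 8 * (1 + n v) := by ring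
        rw [e, ← add_assoc, Real.exp_add (φ 0 v + κ / 8 * (1 + n v))]
        ring
    _ ≤ _ := mul_le_mul_of_nonneg_left (habs v) (by positivity)

/-- The Cramér–Rao inequality in terms of the error `T` and the score `Z`. -/
theorem trace_inv_le_integral_norm_sq {ι E : Type*} [Fintype ι] [DecidableEq ι]
    [MeasurableSpace E] {ν : Measure E} {T : E → EuclideanSpace ℝ ι} {Z : ι → E → ℝ}
    {J : Matrix ι ι ℝ} (hJ : IsUnit J)
    (hT : ∀ i, Integrable (fun v => T v i ^ 2) ν)
    (hTZ : ∀ i p, Integrable (fun v => T v i * Z p v) ν)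
    (hZ : ∀ p q, Integrable (fun v => Z p v * Z q v) ν)
    (hcov : ∀ i p, ∫ v, T v i * Z p v ∂ν = if i = p then 1 else 0)
    (hfisher : ∀ p q, ∫ v, Z p v * Z q v ∂ν = J p q) :
    J⁻¹.trace ≤ ∫ v, ‖T v‖ ^ 2 ∂ν := by
  have hinv : J⁻¹ * J = 1 := Matrix.nonsing_inv_mul _ ((Matrix.isUnit_iff_isUnit_det J).mp hJ)
  set A := J⁻¹
  have hi : ∀ i, A i i ≤ ∫ v, T v i ^ 2 ∂ν := fun i => by
    -- The residual after subtracting from `T_i` its projection on the scores; expanding its square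
    -- needs only the integrals in the hypotheses.
    have hexp : ∀ v, (T v i - ∑ p, A i p * Z p v) ^ 2 = T v i ^ 2 -
        2 * (∑ p, A i p * (T v i * Z p v)) + ∑ p, ∑ q, A i p * A i q * (Z p v * Z q v) := fun v => by
      have e1 : ∑ p, A i p * (T v i * Z p v) = T v i * ∑ p, A i p * Z p v := by
        rw [Finset.mul_sum]
        exact Finset.sum_congr rfl fun p _ => by ring
      have e2 : ∑ p, ∑ q, A i p * A i q * (Z p v * Z q v) = (∑ p, A i p * Z p v) ^ 2 := by
        rw [sq, Finset.sum_mul_sum]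
        exact Finset.sum_congr rfl fun p _ => Finset.sum_congr rfl fun q _ => by ring
      rw [e1, e2]
      ring
    have h0 : 0 ≤ ∫ v, (T v i - ∑ p, A i p * Z p v) ^ 2 ∂ν := integral_nonneg fun v => sq_nonneg _
    have hI1 : ∀ p ∈ Finset.univ, Integrable (fun v => A i p * (T v i * Z p v)) ν :=
      fun p _ => (hTZ i p).const_mul _
    have hI2 : ∀ p q, Integrable (fun v => A i p * A i q * (Z p v * Z q v)) ν :=
      fun p q => (hZ p q).const_mul _
    have hI3 : ∀ p ∈ Finset.univ, Integrable (fun v => ∑ q, A i p * A i q * (Z p v * Z q v)) ν :=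
      fun p _ => integrable_finsetSum _ fun q _ => hI2 p q
    simp_rw [hexp] at h0
    rw [integral_add (f := fun v => _ - _) ((hT i).sub ((integrable_finsetSum _ hI1).const_mul 2))
      (integrable_finsetSum _ hI3),
      integral_sub (hT i) ((integrable_finsetSum _ hI1).const_mul 2), integral_const_mul,
      integral_finsetSum _ hI1, integral_finsetSum _ hI3] at h0
    simp_rw [integral_finsetSum _ fun q _ => hI2 _ q, integral_const_mul, hcov, hfisher] at h0
    -- Since `AJ = 1`, the matrix `AJAᵀ` equals `Aᵀ`, which has the same diagonal as `A`.
    have e : ∑ p, ∑ q, A i p * A i q * J p q = A i i := by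
      have h : (A * J * Aᵀ) i i = A i i := by rw [hinv, one_mul, Matrix.transpose_apply]
      rw [Matrix.mul_apply] at h
      simp_rw [Matrix.mul_apply, Finset.sum_mul, Matrix.transpose_apply] at h
      rw [← h, Finset.sum_comm]
      exact Finset.sum_congr rfl fun p _ => Finset.sum_congr rfl fun q _ => by ring
    rw [e] at h0
    simp at h0
    linarith
  calc A.trace ≤ ∑ i, ∫ v, T v i ^ 2 ∂ν := Finset.sum_le_sum fun i _ => hi i
    _ = ∫ v, ∑ i, T v i ^ 2 ∂ν := (integral_finsetSum _ fun i _ => hT i).symm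
    _ = _ := by simp_rw [EuclideanSpace.real_norm_sq_eq]

end BeamTracking

/-! ### Joint law and score of all cycles. -/

namespace BeamTracking

variable {M N k : ℕ} {S σβ σz : ℝ} (W : Fin k → Matrix (Fin M × Fin N) (Fin 3) ℂ)

/-- The log-likelihood of the observations of all cycles. -/
noncomputable def jointLogPDF (S σβ σz : ℝ) (W : Fin k → Matrix (Fin M × Fin N) (Fin 3) ℂ)
    (x : EuclideanSpace ℝ (Fin 2)) (v : Fin k → Fin 3 → ℂ) : ℝ :=
  ∑ l, Real.log (pDI S σβ σz (W l) x (v l))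

/-- The score of the observations of all cycles. -/
noncomputable def jointScore (S σβ σz : ℝ) (W : Fin k → Matrix (Fin M × Fin N) (Fin 3) ℂ)
    (x : EuclideanSpace ℝ (Fin 2)) (p : Fin 2) (v : Fin k → Fin 3 → ℂ) : ℝ :=
  ∑ l, scoreDI S σβ σz (W l) x p (v l)

/-- The joint law of the observations of all cycles. -/
noncomputable abbrev jointLaw (S σβ σz : ℝ) (W : Fin k → Matrix (Fin M × Fin N) (Fin 3) ℂ)
    (x : EuclideanSpace ℝ (Fin 2)) : Measure (Fin k → Fin 3 → ℂ) :=
  Measure.pi fun l => obsLaw S σβ σz (W l) x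

theorem measurable_jointLogPDF (x : EuclideanSpace ℝ (Fin 2)) :
    Measurable (jointLogPDF S σβ σz W x) := by
  refine Finset.measurable_sum _ fun l _ => Measurable.log ?_
  exact (continuous_pDI (W l) x).measurable.comp (measurable_pi_apply l)

theorem measurable_jointScore (hσz : 0 < σz) (x : EuclideanSpace ℝ (Fin 2)) (p : Fin 2) :
    Measurable (jointScore S σβ σz W x p) :=
  Finset.measurable_sum _ fun l _ =>
    (continuous_scoreDI (W l) x p hσz).measurable.comp (measurable_pi_apply l)

theorem exp_jointLogPDF (hσz : 0 < σz) (x : EuclideanSpace ℝ (Fin 2)) (v : Fin k → Fin 3 → ℂ) :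
    Real.exp (jointLogPDF S σβ σz W x v) = ∏ l, pDI S σβ σz (W l) x (v l) := by
  rw [jointLogPDF, Real.exp_sum]
  exact Finset.prod_congr rfl fun l _ => Real.exp_log (pDI_pos (W l) S σβ hσz x _)

theorem jointLaw_eq (hσβ : 0 < σβ) (hσz : 0 < σz) (x : EuclideanSpace ℝ (Fin 2)) :
    jointLaw S σβ σz W x =
      volume.withDensity fun v => ENNReal.ofReal (Real.exp (jointLogPDF S σβ σz W x v)) := by
  have hint (l) : Integrable (pDI S σβ σz (W l) x) := by
    have := isProbabilityMeasure_obsLaw (S := S) (W l) hσβ hσz x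
    simpa using (integrable_obsLaw_iff_mul_pDI (W l) x hσz).mp
      (integrable_const (μ := obsLaw S σβ σz (W l) x) (1 : ℝ))
  simp_rw [exp_jointLogPDF W hσz]
  exact pi_withDensity_ofReal _ (fun l => pDI S σβ σz (W l) x) hint
    fun l v => (pDI_pos (W l) S σβ hσz x v).le

theorem integrable_jointLaw_iff (hσβ : 0 < σβ) (hσz : 0 < σz) (x : EuclideanSpace ℝ (Fin 2))
    {f : (Fin k → Fin 3 → ℂ) → ℝ} :
    Integrable f (jointLaw S σβ σz W x) ↔
      Integrable fun v => f v * Real.exp (jointLogPDF S σβ σz W x v) := by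
  rw [jointLaw_eq W hσβ hσz, integrable_withDensity_iff_integrable_smul'
    (measurable_jointLogPDF W x).exp.ennreal_ofReal
    (ae_of_all _ fun _ => ENNReal.ofReal_lt_top)]
  refine integrable_congr (ae_of_all _ fun y => ?_)
  simp [ENNReal.toReal_ofReal (Real.exp_pos _).le, mul_comm]

theorem integral_jointLaw (hσβ : 0 < σβ) (hσz : 0 < σz) (x : EuclideanSpace ℝ (Fin 2))
    (f : (Fin k → Fin 3 → ℂ) → ℝ) :
    ∫ v, f v ∂jointLaw S σβ σz W x = ∫ v, f v * Real.exp (jointLogPDF S σβ σz W x v) := by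
  rw [jointLaw_eq W hσβ hσz, integral_withDensity_eq_integral_toReal_smul
    (measurable_jointLogPDF W x).exp.ennreal_ofReal
    (ae_of_all _ fun _ => ENNReal.ofReal_lt_top)]
  refine integral_congr_ae (ae_of_all _ fun y => ?_)
  simp [ENNReal.toReal_ofReal (Real.exp_pos _).le, mul_comm]

theorem hasDerivAt_jointLogPDF (hσz : 0 < σz) (x : EuclideanSpace ℝ (Fin 2)) (p : Fin 2)
    (t : ℝ) (v : Fin k → Fin 3 → ℂ) :
    HasDerivAt (fun u : ℝ => jointLogPDF S σβ σz W (x + u • EuclideanSpace.single p (1 : ℝ)) v)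
      (jointScore S σβ σz W (x + t • EuclideanSpace.single p (1 : ℝ)) p v) t :=
  HasDerivAt.fun_sum fun l _ => hasDerivAt_line
    ((contDiff_log_pDI (W l) S σβ hσz (v l)).differentiable one_ne_zero) x p t

theorem integrable_exp_neg_sum_norm_sq {a : ℝ} (ha : 0 < a) :
    Integrable fun v : Fin k → Fin 3 → ℂ => Real.exp (-a * ∑ l, ∑ i, ‖v l i‖ ^ 2) := by
  have h1 : Integrable fun w : ℂ => Real.exp (-a * ‖w‖ ^ 2) := by
    have h := integral_exp_neg_mul_norm_sub_sq ha 0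
    simp only [sub_zero] at h
    have := Real.pi_pos
    exact Integrable.of_integral_ne_zero (h.trans_ne (by positivity))
  have h2 : Integrable fun y : Fin 3 → ℂ => ∏ i, Real.exp (-a * ‖y i‖ ^ 2) :=
    Integrable.fintype_prod_dep fun _ => h1
  have h3 : Integrable fun v : Fin k → Fin 3 → ℂ => ∏ l, ∏ i, Real.exp (-a * ‖v l i‖ ^ 2) :=
    Integrable.fintype_prod_dep (f := fun (l : Fin k) (y : Fin 3 → ℂ) =>
      ∏ i, Real.exp (-a * ‖y i‖ ^ 2)) fun _ => h2
  simpa only [Finset.mul_sum, Real.exp_sum] using h3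

theorem exists_jointLogPDF_le (hσz : 0 < σz) (x : EuclideanSpace ℝ (Fin 2)) :
    ∃ κ K : ℝ, 0 < κ ∧ ∀ v : Fin k → Fin 3 → ℂ,
      jointLogPDF S σβ σz W x v ≤ K - κ * ∑ l, ∑ i, ‖v l i‖ ^ 2 := by
  have hD := fun l => topEig_pos (W l) S σβ hσz x
  have hs : 0 ≤ ∑ l, topEig S σβ σz (W l) x := Finset.sum_nonneg fun l _ => (hD l).le
  -- One rate below every `1/D_l`; the summand `1` keeps the inverse positive when there are no
  -- cycles.
  refine ⟨(1 + ∑ l, topEig S σβ σz (W l) x)⁻¹, ∑ l, (-Real.log (Real.pi ^ 3 * σz ^ 4) -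
    Real.log (topEig S σβ σz (W l) x)), by positivity, fun v => ?_⟩
  rw [jointLogPDF, Finset.mul_sum, ← Finset.sum_sub_distrib]
  refine Finset.sum_le_sum fun l _ => (log_pDI_le (W l) S σβ hσz x (v l)).trans ?_
  refine sub_le_sub_left (mul_le_mul_of_nonneg_right ?_ (by positivity)) _
  refine inv_anti₀ (hD l) ?_
  have := Finset.single_le_sum (f := fun l => topEig S σβ σz (W l) x) (fun l _ => (hD l).le)
    (Finset.mem_univ l)
  linarith

theorem exists_abs_jointScore_le (hσz : 0 < σz) (x : EuclideanSpace ℝ (Fin 2)) (p : Fin 2) :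
    ∃ C δ : ℝ, 0 < C ∧ 0 < δ ∧ ∀ t : ℝ, |t| < δ → ∀ v : Fin k → Fin 3 → ℂ,
      |jointScore S σβ σz W (x + t • EuclideanSpace.single p (1 : ℝ)) p v| ≤
        C * (1 + ∑ l, ∑ i, ‖v l i‖ ^ 2) := by
  let c : EuclideanSpace ℝ (Fin 2) → ℝ := fun x' => ∑ l,
    ((∑ a, ∑ b, ‖scoreMat S σβ σz (W l) x' p a b‖) +
      |S ^ 2 * σβ ^ 2 * gTilde (W l) x' p / topEig S σβ σz (W l) x'|)
  have hc0 : ∀ x', 0 ≤ c x' := fun x' => by positivity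
  have hc : Continuous fun t : ℝ => c (x + t • EuclideanSpace.single p (1 : ℝ)) := by
    refine Continuous.comp (g := c) ?_ (by fun_prop)
    exact continuous_finsetSum _ fun l _ => (continuous_finsetSum _ fun a _ =>
      continuous_finsetSum _ fun b _ => (continuous_scoreMat (W l) S σβ hσz p a b).norm).add
      (continuous_gTilde_div_topEig (W l) S σβ hσz p).abs
  -- By continuity the coefficient stays below its value at `0` plus one, so one constant serves all
  -- small `t`.
  have hev := (hc.tendsto 0).eventually_lt_const (lt_add_one _)
  obtain ⟨δ, hδ, hball⟩ := Metric.eventually_nhds_iff.mp hev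
  refine ⟨c (x + (0 : ℝ) • EuclideanSpace.single p (1 : ℝ)) + 1, δ,
    add_pos_of_nonneg_of_pos (hc0 _) one_pos, hδ, fun t ht v => ?_⟩
  have hct := (hball (y := t) (by simpa using ht)).le
  refine le_trans ?_ (mul_le_mul_of_nonneg_right hct (by positivity))
  set x' := x + t • EuclideanSpace.single p (1 : ℝ)
  rw [jointScore, Finset.sum_mul]
  refine (Finset.abs_sum_le_sum_abs _ _).trans (Finset.sum_le_sum fun l _ => ?_)
  rw [scoreDI_eq (W l) S σβ hσz]
  refine (abs_sub _ _).trans ?_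
  have h1 := abs_quadForm_le (scoreMat S σβ σz (W l) x' p) (v l)
  have h2 : ∑ i, ‖v l i‖ ^ 2 ≤ ∑ l, ∑ i, ‖v l i‖ ^ 2 :=
    Finset.single_le_sum (f := fun l => ∑ i, ‖v l i‖ ^ 2) (fun l _ => by positivity)
      (Finset.mem_univ l)
  have h3 : 0 ≤ ∑ a, ∑ b, ‖scoreMat S σβ σz (W l) x' p a b‖ := by positivity
  have h4 := abs_nonneg (S ^ 2 * σβ ^ 2 * gTilde (W l) x' p / topEig S σβ σz (W l) x')
  have h5 : 0 ≤ ∑ i, ‖v l i‖ ^ 2 := by positivity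
  nlinarith

/-- The expectation of a square integrable function of the observations is differentiable in the
direction, and the score represents its derivative. -/
theorem hasDerivAt_integral_jointLaw (hσβ : 0 < σβ) (hσz : 0 < σz)
    (x : EuclideanSpace ℝ (Fin 2)) (p : Fin 2) {F : (Fin k → Fin 3 → ℂ) → ℝ} (hF : Measurable F)
    (hF2 : Integrable (fun v => F v ^ 2) (jointLaw S σβ σz W x)) :
    Integrable (fun v => F v * jointScore S σβ σz W x p v) (jointLaw S σβ σz W x) ∧
      HasDerivAt (fun t : ℝ => ∫ v, F v ∂jointLaw S σβ σz W
          (x + t • EuclideanSpace.single p (1 : ℝ)))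
        (∫ v, F v * jointScore S σβ σz W x p v ∂jointLaw S σβ σz W x) 0 := by
  obtain ⟨κ, K, hκ, hK⟩ := exists_jointLogPDF_le (S := S) (σβ := σβ) W hσz x
  obtain ⟨C, δ, hC, hδ, hb⟩ := exists_abs_jointScore_le (S := S) (σβ := σβ) W hσz x p
  have h := hasDerivAt_integral_mul_exp (ν := volume) (F := F) (κ := κ) (K := K)
    (φ := fun t => jointLogPDF S σβ σz W (x + t • EuclideanSpace.single p (1 : ℝ)))
    (φ' := fun t => jointScore S σβ σz W (x + t • EuclideanSpace.single p (1 : ℝ)) p)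
    hδ hC hκ (fun t => measurable_jointLogPDF W _) (measurable_jointScore W hσz _ p)
    (fun v => by positivity) hF (hasDerivAt_jointLogPDF W hσz x p) hb (by simpa using hK)
    (fun a ha => integrable_exp_neg_sum_norm_sq ha)
    (by simpa using (integrable_jointLaw_iff W hσβ hσz x).mp hF2)
  simp only [zero_smul, add_zero] at h
  have e : ∀ v, F v * (Real.exp (jointLogPDF S σβ σz W x v) * jointScore S σβ σz W x p v) =
      F v * jointScore S σβ σz W x p v * Real.exp (jointLogPDF S σβ σz W x v) := fun v => by ring
  simp_rw [e] at h
  rw [integrable_jointLaw_iff W hσβ hσz]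
  simp_rw [integral_jointLaw W hσβ hσz]
  exact h

/-! ### Additivity of the Fisher information. -/

section JointFisher

variable (x : EuclideanSpace ℝ (Fin 2)) (p j : Fin 2)

theorem indepFun_scoreDI (hσβ : 0 < σβ) (hσz : 0 < σz) {l m : Fin k} (h : l ≠ m) :
    IndepFun (fun v : Fin k → Fin 3 → ℂ => scoreDI S σβ σz (W l) x p (v l))
      (fun v => scoreDI S σβ σz (W m) x j (v m)) (jointLaw S σβ σz W x) := by
  have := fun l => isProbabilityMeasure_obsLaw (S := S) (W l) hσβ hσz x
  have hi : iIndepFun (fun l (v : Fin k → Fin 3 → ℂ) => v l) (jointLaw S σβ σz W x) :=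
    iIndepFun_pi (X := fun _ v => v) fun _ => aemeasurable_id
  exact (hi.indepFun h).comp (continuous_scoreDI (W l) x p hσz).measurable
    (continuous_scoreDI (W m) x j hσz).measurable

theorem integrable_jointLaw_scoreDI_mul (hσβ : 0 < σβ) (hσz : 0 < σz) (l m : Fin k) :
    Integrable (fun v : Fin k → Fin 3 → ℂ => scoreDI S σβ σz (W l) x p (v l) *
      scoreDI S σβ σz (W m) x j (v m)) (jointLaw S σβ σz W x) := by
  have := fun l => isProbabilityMeasure_obsLaw (S := S) (W l) hσβ hσz x
  have hmp := fun l => measurePreserving_eval (fun l => obsLaw S σβ σz (W l) x) l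
  by_cases h : l = m
  · subst h
    exact (hmp l).integrable_comp_of_integrable (integrable_scoreDI_mul (W l) x p j hσβ hσz)
  · exact (indepFun_scoreDI W x p j hσβ hσz h).integrable_mul
      ((hmp l).integrable_comp_of_integrable (integrable_scoreDI (W l) x p hσβ hσz))
      ((hmp m).integrable_comp_of_integrable (integrable_scoreDI (W m) x j hσβ hσz))

/-- Scores of distinct cycles are independent and centred, so the cross terms vanish. -/
theorem integral_jointLaw_scoreDI_mul (hσβ : 0 < σβ) (hσz : 0 < σz) (l m : Fin k) :
    ∫ v : Fin k → Fin 3 → ℂ, scoreDI S σβ σz (W l) x p (v l) *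
      scoreDI S σβ σz (W m) x j (v m) ∂jointLaw S σβ σz W x =
      if l = m then fisherDI S σβ σz (W l) x p j else 0 := by
  have := fun l => isProbabilityMeasure_obsLaw (S := S) (W l) hσβ hσz x
  have hmp := fun l => measurePreserving_eval (fun l => obsLaw S σβ σz (W l) x) l
  have hev (l) {f : (Fin 3 → ℂ) → ℝ} (hf : Continuous f) :
      ∫ v, f (v l) ∂jointLaw S σβ σz W x = ∫ y, f y ∂obsLaw S σβ σz (W l) x := by
    rw [← (hmp l).map_eq, integral_map (measurable_pi_apply l).aemeasurable
      hf.aestronglyMeasurable]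
  have hc (l p) := continuous_scoreDI (S := S) (σβ := σβ) (W l) x p hσz
  split_ifs with h
  · subst h
    rw [hev l (f := fun y => scoreDI S σβ σz (W l) x p y * scoreDI S σβ σz (W l) x j y)
      ((hc l p).mul (hc l j)), fisherDI_eq_integral_obsLaw (W l) x p j hσz]
  · rw [(indepFun_scoreDI W x p j hσβ hσz h).integral_fun_mul_eq_mul_integral
      ((hc l p).comp (continuous_apply l)).aestronglyMeasurable
      ((hc m j).comp (continuous_apply m)).aestronglyMeasurable, hev l (hc l p),
      integral_scoreDI (W l) x p hσβ hσz, zero_mul]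

theorem jointScore_mul_eq (v : Fin k → Fin 3 → ℂ) :
    jointScore S σβ σz W x p v * jointScore S σβ σz W x j v =
      ∑ l, ∑ m, scoreDI S σβ σz (W l) x p (v l) * scoreDI S σβ σz (W m) x j (v m) :=
  Finset.sum_mul_sum _ _ _ _

theorem integrable_jointScore_mul (hσβ : 0 < σβ) (hσz : 0 < σz) :
    Integrable (fun v => jointScore S σβ σz W x p v * jointScore S σβ σz W x j v)
      (jointLaw S σβ σz W x) := by
  simp_rw [jointScore_mul_eq]
  exact integrable_finsetSum _ fun l _ => integrable_finsetSum _ fun m _ =>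
    integrable_jointLaw_scoreDI_mul W x p j hσβ hσz l m

/-- The Fisher information of independent cycles is additive. -/
theorem integral_jointScore_mul (hσβ : 0 < σβ) (hσz : 0 < σz) :
    ∫ v, jointScore S σβ σz W x p v * jointScore S σβ σz W x j v ∂jointLaw S σβ σz W x =
      (∑ l, fisherDI S σβ σz (W l) x) p j := by
  simp_rw [jointScore_mul_eq]
  have hi := integrable_jointLaw_scoreDI_mul (S := S) W x p j hσβ hσz
  rw [integral_finsetSum _ fun l _ => integrable_finsetSum _ fun m _ => hi l m]
  simp_rw [integral_finsetSum _ fun m _ => hi _ m, integral_jointLaw_scoreDI_mul W x p j hσβ hσz]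
  simp [Matrix.sum_apply]

end JointFisher

end BeamTracking

/-! ### The probabilistic model and the Cramér–Rao bound. -/

namespace BeamTracking

section Model

variable {Ω : Type*} [MeasurableSpace Ω] {μ : Measure Ω}
  {M N k : ℕ} {S σβ σz : ℝ} (W : Fin k → Matrix (Fin M × Fin N) (Fin 3) ℂ)
  {β : Fin k → Ω → ℂ} {z : Fin k → Fin 3 → Ω → ℂ}

/-- The law of the gains and noise entries of all cycles, grouped by cycle. -/
theorem hasLaw_gain_noise
    (hβ : ∀ l, HasLaw (β l) (complexGaussian σβ) μ)
    (hz : ∀ l i, HasLaw (z l i) (complexGaussian σz) μ)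
    (hindep : iIndepFun (Sum.elim β fun q : Fin k × Fin 3 => z q.1 q.2) μ) :
    HasLaw (fun ω (l : Fin k) (m : Fin 4) =>
        (Fin.cons (β l ω) (fun i => z l i ω) : Fin 4 → ℂ) m)
      (Measure.pi fun _ : Fin k => gaussianPi (deviations σβ σz)) μ := by
  -- Coordinate `0` of a cycle is its gain and the others are its noise entries. This reindexing
  -- keeps the independence because it is injective; currying then groups by cycle.
  let e : ((_ : Fin k) × Fin 4) → Fin k ⊕ Fin k × Fin 3 := fun q =>
    Fin.cases (motive := fun _ => Fin k ⊕ Fin k × Fin 3) (Sum.inl q.1) (fun i => Sum.inr (q.1, i)) q.2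
  have he : Function.Injective e := by
    rintro ⟨l, m⟩ ⟨l', m'⟩
    refine Fin.cases ?_ (fun i => ?_) m <;> refine Fin.cases ?_ (fun i' => ?_) m' <;>
      simp +contextual [e]
  have hlaw (q : (_ : Fin k) × Fin 4) :
      HasLaw (Sum.elim β (fun q : Fin k × Fin 3 => z q.1 q.2) (e q))
        (complexGaussian (deviations σβ σz q.2)) μ := by
    obtain ⟨l, m⟩ := q
    refine Fin.cases ?_ (fun i => ?_) m
    · exact hβ l
    · exact hz l i
  have h := (hindep.precomp he).hasLaw_pi hlaw
  have hc := Measure.infinitePi_map_piCurry (X := fun (_ : Fin k) (_ : Fin 4) => ℂ)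
    (fun (_ : Fin k) (m : Fin 4) => complexGaussian (deviations σβ σz m))
  simp only [Measure.infinitePi_eq_pi] at hc
  have hcl : HasLaw (MeasurableEquiv.piCurry fun (_ : Fin k) (_ : Fin 4) => ℂ)
      (Measure.pi fun _ : Fin k => gaussianPi (deviations σβ σz))
      (Measure.pi fun q : (_ : Fin k) × Fin 4 => complexGaussian (deviations σβ σz q.2)) :=
    ⟨(MeasurableEquiv.measurable _).aemeasurable, hc⟩
  refine (hcl.comp h).congr (ae_of_all _ fun ω => ?_)
  funext l m
  refine Fin.cases ?_ (fun i => ?_) m <;> rfl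

/-- The law of the observations of all cycles. -/
theorem hasLaw_observations (hσβ : 0 < σβ) (hσz : 0 < σz)
    (hβ : ∀ l, HasLaw (β l) (complexGaussian σβ) μ)
    (hz : ∀ l i, HasLaw (z l i) (complexGaussian σz) μ)
    (hindep : iIndepFun (Sum.elim β fun q : Fin k × Fin 3 => z q.1 q.2) μ)
    (x : EuclideanSpace ℝ (Fin 2)) :
    HasLaw (fun ω l => observation S (W l) x (β l ω) fun i => z l i ω)
      (jointLaw S σβ σz W x) μ := by
  have hm (l) : (gaussianPi (deviations σβ σz)).map (observe S (W l) x) =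
      obsLaw S σβ σz (W l) x := map_observe (W l) hσβ hσz x
  have := fun l => isProbabilityMeasure_obsLaw (S := S) (W l) hσβ hσz x
  have (l : Fin k) : SigmaFinite ((gaussianPi (deviations σβ σz)).map (observe S (W l) x)) := by
    rw [hm l]; infer_instance
  have hobs : HasLaw (fun (w : Fin k → Fin 4 → ℂ) l => observe S (W l) x (w l))
      (jointLaw S σβ σz W x) (Measure.pi fun _ : Fin k => gaussianPi (deviations σβ σz)) := by
    refine ⟨?_, ?_⟩
    · exact (measurable_pi_lambda _ fun l =>
        (continuous_observe (W l) x).measurable.comp (measurable_pi_apply l)).aemeasurable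
    · rw [Measure.pi_map_pi (μ := fun _ : Fin k => gaussianPi (deviations σβ σz))
        (f := fun l => observe S (W l) x) fun l => (continuous_observe (W l) x).measurable.aemeasurable]
      simp_rw [hm]
  exact hobs.comp (hasLaw_gain_noise hβ hz hindep)

/-- The Cramér–Rao bound under the law of the observations. -/
theorem trace_inv_sum_fisherDI_le (hσβ : 0 < σβ) (hσz : 0 < σz) (x : EuclideanSpace ℝ (Fin 2))
    {F : (Fin k → Fin 3 → ℂ) → EuclideanSpace ℝ (Fin 2)} (hF : Measurable F)
    (hunb : ∀ᶠ x' in 𝓝 x, Integrable F (jointLaw S σβ σz W x') ∧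
      ∫ v, F v ∂jointLaw S σβ σz W x' = x')
    (hJ : IsUnit (∑ l, fisherDI S σβ σz (W l) x)) :
    ENNReal.ofReal (∑ l, fisherDI S σβ σz (W l) x)⁻¹.trace ≤
      ∫⁻ v, ENNReal.ofReal (‖F v - x‖ ^ 2) ∂jointLaw S σβ σz W x := by
  have := fun x' l => isProbabilityMeasure_obsLaw (S := S) (W l) hσβ hσz x'
  -- If the mean square error is infinite there is nothing to prove; otherwise the error is square
  -- integrable, as differentiation of its mean requires.
  by_cases htop : ∫⁻ v, ENNReal.ofReal (‖F v - x‖ ^ 2) ∂jointLaw S σβ σz W x = ⊤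
  · exact le_top.trans_eq htop.symm
  have hT : Integrable (fun v => ‖F v - x‖ ^ 2) (jointLaw S σβ σz W x) := by
    refine ⟨((hF.sub_const x).norm.pow_const 2).aestronglyMeasurable, ?_⟩
    rw [hasFiniteIntegral_iff_ofReal (ae_of_all _ fun v => by positivity)]
    exact lt_top_iff_ne_top.mpr htop
  have hmeas (i : Fin 2) : Measurable fun v => (F v - x) i :=
    (EuclideanSpace.proj i : EuclideanSpace ℝ (Fin 2) →L[ℝ] ℝ).continuous.measurable.comp
      (hF.sub_const x)
  have hTi (i : Fin 2) : Integrable (fun v => (F v - x) i ^ 2) (jointLaw S σβ σz W x) := by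
    refine hT.mono' ((hmeas i).pow_const 2).aestronglyMeasurable (ae_of_all _ fun v => ?_)
    rw [Real.norm_eq_abs, abs_of_nonneg (sq_nonneg _), EuclideanSpace.real_norm_sq_eq]
    exact Finset.single_le_sum (f := fun i => (F v - x) i ^ 2) (fun i _ => sq_nonneg _)
      (Finset.mem_univ i)
  have hder (i p : Fin 2) := hasDerivAt_integral_jointLaw W hσβ hσz x p (hmeas i) (hTi i)
  have hcov (i p : Fin 2) : ∫ v, (F v - x) i * jointScore S σβ σz W x p v
      ∂jointLaw S σβ σz W x = if i = p then 1 else 0 := by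
    have hline : Tendsto (fun t : ℝ => x + t • EuclideanSpace.single p (1 : ℝ)) (𝓝 0) (𝓝 x) :=
      Continuous.tendsto' (by fun_prop) _ _ (by simp)
    -- At the true direction `x + t e_p`, unbiasedness makes the mean of `F - x` equal to `t e_p`.
    -- Its derivative is compared with the one expressed by the score.
    have hmean : (fun t : ℝ => ∫ v, (F v - x) i ∂jointLaw S σβ σz W
        (x + t • EuclideanSpace.single p (1 : ℝ))) =ᶠ[𝓝 0] fun t => t * if i = p then 1 else 0 := by
      filter_upwards [hline.eventually hunb] with t ht
      have h := (EuclideanSpace.proj i : EuclideanSpace ℝ (Fin 2) →L[ℝ] ℝ).integral_comp_comm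
        (ht.1.sub (integrable_const x))
      refine h.trans ?_
      simp only [Pi.sub_apply]
      rw [integral_sub ht.1 (integrable_const x), ht.2]
      simp
    have h1 := (hder i p).2.congr_of_eventuallyEq hmean.symm
    have h2 : HasDerivAt (fun t : ℝ => t * if i = p then (1 : ℝ) else 0)
        (if i = p then 1 else 0) 0 := by
      simpa using (hasDerivAt_id (0 : ℝ)).mul_const (if i = p then (1 : ℝ) else 0)
    exact h1.unique h2
  have hcr := trace_inv_le_integral_norm_sq (T := fun v => F v - x)
    (Z := fun p => jointScore S σβ σz W x p) hJ hTi (fun i p => (hder i p).1)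
    (fun p q => integrable_jointScore_mul W x p q hσβ hσz) hcov
    (fun p q => integral_jointScore_mul W x p q hσβ hσz)
  rw [← ofReal_integral_eq_lintegral_ofReal hT (ae_of_all _ fun v => by positivity)]
  exact ENNReal.ofReal_le_ofReal hcr

end Model

end BeamTracking

open BeamTracking in
theorem lemma4 {Ω : Type*} [MeasurableSpace Ω] (μ : Measure Ω) [IsProbabilityMeasure μ]
    (M N k L : ℕ)
    -- pilot sequence and standard deviations of the equivalent channel gain and of the noise
    (s : EuclideanSpace ℂ (Fin L)) (hs : s ≠ 0)
    (σβ σz : ℝ) (hσβ : 0 < σβ) (hσz : 0 < σz)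
    -- the given exploring beamforming matrices
    (W : Fin k → Matrix (Fin M × Fin N) (Fin 3) ℂ)
    -- equivalent channel gains (Rayleigh fading) and observation noise
    (β : Fin k → Ω → ℂ) (z : Fin k → Fin 3 → Ω → ℂ)
    (hβ : ∀ l, HasLaw (β l) (complexGaussian σβ) μ)
    (hz : ∀ l i, HasLaw (z l i) (complexGaussian σz) μ)
    (hindep : iIndepFun (Sum.elim β fun q : Fin k × Fin 3 => z q.1 q.2) μ)
    -- the observations of the `k` cycles as a function of the direction
    (y : EuclideanSpace ℝ (Fin 2) → Ω → Fin k → Fin 3 → ℂ)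
    (hy : ∀ x ω l, y x ω l = observation ‖s‖ (W l) x (β l ω) (fun i => z l i ω))
    (x : EuclideanSpace ℝ (Fin 2)) :
    -- the Cramér–Rao bound for every estimator that is unbiased for all directions near `x`
    (∀ F : (Fin k → Fin 3 → ℂ) → EuclideanSpace ℝ (Fin 2), Measurable F →
      (∀ᶠ x' in 𝓝 x, Integrable (fun ω => F (y x' ω)) μ ∧ ∫ ω, F (y x' ω) ∂μ = x') →
      IsUnit (∑ l, fisherDI ‖s‖ σβ σz (W l) x) →
      ENNReal.ofReal (∑ l, fisherDI ‖s‖ σβ σz (W l) x)⁻¹.trace ≤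
        ∫⁻ ω, ENNReal.ofReal (‖F (y x ω) - x‖ ^ 2) ∂μ) ∧
    -- the entries of the Fisher information matrices
    (∀ (l : Fin k) (p j : Fin 2),
      Integrable (fun v : Fin 3 → ℂ => scoreDI ‖s‖ σβ σz (W l) x p v *
        scoreDI ‖s‖ σβ σz (W l) x j v * pDI ‖s‖ σβ σz (W l) x v) ∧
      ((fisherDI ‖s‖ σβ σz (W l) x p j : ℝ) : ℂ) =
        (σz ^ 6 * ‖s‖ ^ 6 * σβ ^ 6 : ℝ) / (covDI ‖s‖ σβ σz (W l) x).det ^ 2 *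
          (-2 * (gSq (W l) x : ℂ) * (gTilde (W l) x p : ℂ) * (gTilde (W l) x j : ℂ)
            + ((σz ^ 2 / (‖s‖ ^ 2 * σβ ^ 2) : ℝ) : ℂ) *
                (gMat (W l) x p * gMat (W l) x j).trace
            + star (gVec (W l) x) ⬝ᵥ
                ((gMat (W l) x p * gMat (W l) x j + gMat (W l) x j * gMat (W l) x p) *ᵥ
                  gVec (W l) x))) := by
  refine ⟨fun F hF hunb hJ => ?_, fun l p j => ⟨?_, ?_⟩⟩
  · have hlaw (x') : HasLaw (y x') (jointLaw ‖s‖ σβ σz W x') μ := by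
      have hyx : y x' = fun ω l => observation ‖s‖ (W l) x' (β l ω) fun i => z l i ω :=
        funext fun ω => funext fun l => hy x' ω l
      rw [hyx]
      exact hasLaw_observations W hσβ hσz hβ hz hindep x'
    have hmean : ∀ᶠ x' in 𝓝 x, Integrable F (jointLaw ‖s‖ σβ σz W x') ∧
        ∫ v, F v ∂jointLaw ‖s‖ σβ σz W x' = x' := by
      filter_upwards [hunb] with x' h
      rw [← (hlaw x').map_eq, integrable_map_measure hF.aestronglyMeasurable (hlaw x').aemeasurable,
        integral_map (hlaw x').aemeasurable hF.aestronglyMeasurable]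
      exact h
    refine (trace_inv_sum_fisherDI_le W hσβ hσz x hF hmean hJ).trans_eq ?_
    exact ((hlaw x).lintegral_comp
      ((hF.sub_const x).norm.pow_const 2).ennreal_ofReal.aemeasurable).symm
  · exact (integrable_obsLaw_iff_mul_pDI (W l) x hσz).mp
      (integrable_scoreDI_mul (W l) x p j hσβ hσz)
  · exact fisherDI_eq (W l) x p j (norm_pos_iff.mpr hs) hσβ hσz
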